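/- For $n\ge 1$ let $S_n$ be the group of permutations of $[n]=\{1,\dots,n\}$ under composition, with $\sigma\in S_n$ also written as the vector $[\sigma(1),\dots,\sigma(n)]$. For $1\le j\le n$ let $t_{\uparrow j}:S_n\to S_n$ be the (bijective) push-to-the-top map $$t_{\uparrow j}([a_1,\dots,a_{j-1},a_j,a_{j+1},\dots,a_n])=[a_j,a_1,\dots,a_{j-1},a_{j+1},\dots,a_n].$$ A $G_\uparrow(n,M)$ code is a sequence $(c_1,\dots,c_M)$ of $M\ge 1$ pairwise distinct elements of $S_n$ such that each of $c_2,\dots,c_M$ is obtained from its predecessor, and $c_1$ from $c_M$, by applying some $t_{\uparrow j}$ with $2\le j\le n$. It is parity-preserving if all its elements have the same sign. Fix $m\ge 2$. On $S_{2m+2}$ put $\varphi=t_{\uparrow 2m+2}^{\,2}\circ t_{\uparrow 2m-1}^{-1}$, and for $r\ge 0$ put $$\hat\pi_r=\varphi^r(\mathrm{id}),\qquad \tilde\sigma_r=\bigl(t_{\uparrow 2m+2}^{-1}\hat\pi_r\bigr)\circ(2m+1,\,2m+2).$$ **Theorem.** For all $r\ge 0$ there exists a parity-preserving $G_\uparrow\bigl(2m+2,\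 \tfrac{(2m+1)!}{2}-(2m-1)\bigr)$ code $\hat P_r$ such that: 1. the first permutation in $\hat P_r$ is $\hat\pi_r$; 2. the last permutation in $\hat P_r$ is $t_{\uparrow 2m-1}^{-1}\hat\pi_r$; 3. every $\pi\in\hat P_r$ satisfies $$\pi(2m+2)=\hat\pi_r(2m+2)=\begin{cases}2m+2 & r\equiv 0 \pmod{2m},\\ 2m+1-(r\bmod 2m) & r\not\equiv 0\pmod{2m};\end{cases}$$ 4. $\tilde\sigma_r\notin\hat P_r$. Moreover $\tilde\sigma_r=t_{\uparrow 2m+1}^{-1}(\hat\pi_r)$, and in particular $\tilde\sigma_r(2m+2)=\hat\pi_r(2m+2)$. -/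

import Mathlib

/-!
Permutations of `[n] = {1, …, n}` are modelled by `Equiv.Perm (Fin n)`, the element `i ∈ [n]`
being `i - 1 : Fin n`.  The vector notation `[σ(1), …, σ(n)]` is the list of values of `σ`, and
products are compositions, `(σ * τ) k = σ (τ k)`.
-/

namespace RankMod

open Equiv

/-- The push-to-the-top transition on an index, as a bijection of `S_n` onto itself: it sends
`[a_1, …, a_{j-1}, a_j, a_{j+1}, …, a_n]` to `[a_j, a_1, …, a_{j-1}, a_{j+1}, …, a_n]`
(see the three lemmas below).  With `j : Fin n` this is the transition on the index `j + 1`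
of `[n]`. -/
def pushToTop {n : ℕ} (j : Fin n) : Perm (Perm (Fin n)) :=
  Equiv.mulRight (Fin.cycleRange j)⁻¹

theorem pushToTop_apply {n : ℕ} (j : Fin n) (σ : Perm (Fin n)) (k : Fin n) :
    pushToTop j σ k = σ ((Fin.cycleRange j).symm k) := rfl

theorem pushToTop_apply_zero {n : ℕ} [NeZero n] (j : Fin n) (σ : Perm (Fin n)) :
    pushToTop j σ 0 = σ j := by
  rw [pushToTop_apply, Fin.cycleRange_symm_zero]

theorem pushToTop_apply_succ {n : ℕ} (j : Fin n) (σ : Perm (Fin n)) (k l : Fin n)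
    (hl : (l : ℕ) + 1 = k) (hk : k ≤ j) : pushToTop j σ k = σ l := by
  have : NeZero n := ⟨by have := j.2; omega⟩
  have hlj : l < j := by rw [Fin.lt_def]; rw [Fin.le_def] at hk; omega
  have h : (Fin.cycleRange j) l = k := by
    apply Fin.ext
    rw [Fin.coe_cycleRange_of_lt hlj, hl]
  rw [pushToTop_apply, ← h, Equiv.symm_apply_apply]

theorem pushToTop_apply_of_gt {n : ℕ} (j : Fin n) (σ : Perm (Fin n)) (k : Fin n)
    (hk : j < k) : pushToTop j σ k = σ k := by
  have h : (Fin.cycleRange j) k = k := Fin.cycleRange_of_gt hk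
  rw [pushToTop_apply]
  conv_lhs => rw [← h]
  rw [Equiv.symm_apply_apply]

/-- A `T`-Gray code over `S`: a sequence of pairwise distinct elements in which each element
is followed by its image under some transition in `T`. -/
structure IsGrayCode {S : Type*} (T : Set (S → S)) (C : List S) : Prop where
  nodup : C.Nodup
  step : C.IsChain (fun x y => ∃ t ∈ T, y = t x)

/-- A Gray code is cyclic if its last element is moreover sent to its first one by some
transition in `T`. -/
structure IsCyclicGrayCode {S : Type*} (T : Set (S → S)) (C : List S) : Prop
    extends IsGrayCode T C where
  cyclic : ∃ h : C ≠ [], ∃ t ∈ T, C.head h = t (C.getLast h)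

/-- The push-to-the-top transitions on the indices `2, …, n`. -/
def topTransitions (n : ℕ) : Set (Perm (Fin n) → Perm (Fin n)) :=
  {t | ∃ j : Fin n, 0 < (j : ℕ) ∧ t = pushToTop j}

/-- `C` is a `G_↑(n, M)`: a cyclic push-to-the-top Gray code of size `M` in `S_n`. -/
structure IsPushToTopCode (n M : ℕ) (C : List (Perm (Fin n))) : Prop
    extends IsCyclicGrayCode (topTransitions n) C where
  size : C.length = M

/-- All elements of the code have the same sign. -/
def ParityPreserving {n : ℕ} (C : List (Perm (Fin n))) : Prop :=
  ∀ σ ∈ C, ∀ τ ∈ C, Perm.sign σ = Perm.sign τ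

/-- The element `2m - 1` of `[2m + 2]` (for `m ≥ 1`). -/
def idxA (m : ℕ) : Fin (2 * m + 2) := ⟨2 * m - 2, by omega⟩

/-- The element `2m + 1` of `[2m + 2]`. -/
def idxB (m : ℕ) : Fin (2 * m + 2) := ⟨2 * m, by omega⟩

/-- The element `2m + 2` of `[2m + 2]`. -/
def idxC (m : ℕ) : Fin (2 * m + 2) := ⟨2 * m + 1, by omega⟩

/-- `φ = t_{↑2m+2}² ∘ t_{↑2m-1}⁻¹`. -/
def phi (m : ℕ) : Perm (Perm (Fin (2 * m + 2))) :=
  pushToTop (idxC m) ^ 2 * (pushToTop (idxA m))⁻¹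

/-- `π̂_r = φ^r(id)`. -/
def piHat (m r : ℕ) : Perm (Fin (2 * m + 2)) := (phi m ^ r) 1

/-- `σ̃_r = (t_{↑2m+2}⁻¹ π̂_r) ∘ (2m+1, 2m+2)`. -/
def sigmaTilde (m r : ℕ) : Perm (Fin (2 * m + 2)) :=
  (pushToTop (idxC m))⁻¹ (piHat m r) * swap (idxB m) (idxC m)

end RankMod

/-!
All moves are right multiplications. With `a = t_{↑2m+1}` and `b = t_{↑2m-1}` as permutations of the
first `2m + 1` letters, `b = r * a` for a 3-cycle `r`. The permutation `x ↦ x * a` of the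
alternating group has the left cosets of `⟨a⟩` as its cycles. Replacing `a` by `b` at the three
elements of a coset `{x, x * r, x * r⁻¹}` merges three such cycles if they are distinct. So a
hypertree of cosets of `⟨r⟩`, each adding two new vertices, would yield a single cycle; parity
forbids it, and one starts from a ring instead: doing all replacements along `⟨b⟩` gives the cycle
`⟨b⟩` itself, of length `2m - 1`, and one further cycle through the remaining elements of the cosets
of `⟨a⟩` involved. The second cycle grows to the whole alternating group minus `⟨b⟩`. It contains
`r⁻¹ → a` and misses `1`, and `r⁻¹ = a * b⁻¹`, which accounts for the two ends and the missing
element of the code.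

The cosets of `⟨a⟩` are labelled by pairs `(y, i)`: `y` is the order of the first `2m - 1` letters,
`i` the gap, along the cycle, between the two remaining ones. For fixed `y` there are triples
joining the gaps `i`, `i + 1` and `i + 2` with `i` odd; the triples which change `y` follow the
edges of a Cayley graph of the alternating group of the first `2m - 1` letters.
-/

namespace RankMod

open Equiv Perm
open Subgroup (zpowers mem_zpowers)

section Switching

variable {G : Type*} [Group G] {a r : G}

theorem mk_mul_self (a x : G) : (x * a : G ⧸ zpowers a) = x :=
  QuotientGroup.mk_mul_of_mem x (mem_zpowers a)

theorem mk_mul_inv_self (a x : G) : (x * a⁻¹ : G ⧸ zpowers a) = x :=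
  QuotientGroup.mk_mul_of_mem x (inv_mem (mem_zpowers a))

theorem mk_zpowers_eq_iff_of_pow_three {w x : G} (hr : r ^ 3 = 1) :
    (w : G ⧸ zpowers r) = x ↔ w = x ∨ w = x * r ∨ w = x * r⁻¹ := by
  have hr_inv : r⁻¹ = r ^ 2 := inv_eq_of_mul_eq_one_right (by rw [← pow_succ', hr])
  constructor
  · rw [eq_comm, QuotientGroup.eq]
    rintro ⟨k, hk⟩
    obtain rfl : x * r ^ k = w := by rw [← mul_inv_cancel_left x w, ← hk]
    have hk3 : r ^ k = r ^ (k % 3) := by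
      rw [← Int.emod_add_mul_ediv k 3, zpow_add, zpow_mul, zpow_ofNat, hr]; simp
    rw [hk3, hr_inv]
    rcases (by omega : k % 3 = 0 ∨ k % 3 = 1 ∨ k % 3 = 2) with h | h | h <;> rw [h] <;> simp
  · rintro (rfl | rfl | rfl)
    · rfl
    · exact mk_mul_self _ _
    · exact mk_mul_inv_self _ _

open Classical in
/-- The permutation of `G` which multiplies `x` on the right by `r * a` if the coset of `x` modulo
`⟨r⟩` belongs to `S`, and by `a` otherwise. -/
noncomputable def switched (a r : G) (S : Set (G ⧸ zpowers r)) : Perm G where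
  toFun x := if (x : G ⧸ zpowers r) ∈ S then x * r * a else x * a
  invFun y := if (y * a⁻¹ : G ⧸ zpowers r) ∈ S then y * a⁻¹ * r⁻¹ else y * a⁻¹
  left_inv x := by
    dsimp only
    split_ifs <;> simp_all
  right_inv y := by
    dsimp only
    split_ifs <;> simp_all

variable {S : Set (G ⧸ zpowers r)} {M : Set G} {N : Set (G ⧸ zpowers a)} {v w x : G}

theorem switched_of_mem (h : (x : G ⧸ zpowers r) ∈ S) : switched a r S x = x * r * a := if_pos h

theorem switched_of_notMem (h : (x : G ⧸ zpowers r) ∉ S) : switched a r S x = x * a := if_neg h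

theorem sameCycle_of_forall_mk_eq [Finite G] {F : Perm G} {p : G}
    (hF : ∀ w : G, (w : G ⧸ zpowers a) = p → w ≠ p → F w = w * a)
    (hw : (w : G ⧸ zpowers a) = p) : F.SameCycle w p := by
  obtain ⟨k, hk⟩ := mem_powers_iff_mem_zpowers.2 (QuotientGroup.eq.1 hw)
  replace hk : w * a ^ k = p := eq_inv_mul_iff_mul_eq.1 hk
  induction k generalizing w with
  | zero => rw [← hk, pow_zero, mul_one]
  | succ k ih =>
    by_cases hwp : w = p
    · rw [hwp]
    · rw [← sameCycle_apply_left, hF w hw hwp]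
      exact ih ((mk_mul_self a w).trans hw) (by rw [mul_assoc, ← pow_succ', hk])

/-- Switching along `S` joins the cosets of `⟨a⟩` in `N`: apart from the elements of `M`, the
members of these cosets lie on one cycle. Nothing is switched outside of `N`, and every element
of `M` is. -/
structure IsJoined (a r : G) (M : Set G) (N : Set (G ⧸ zpowers a))
    (S : Set (G ⧸ zpowers r)) : Prop where
  mk_mem : ∀ w : G, (w : G ⧸ zpowers r) ∈ S → (w : G ⧸ zpowers a) ∈ N
  switched_mem : ∀ w ∈ M, (w : G ⧸ zpowers r) ∈ S
  sameCycle : ∀ v w : G, v ∉ M → w ∉ M → (v : G ⧸ zpowers a) ∈ N → (w : G ⧸ zpowers a) ∈ N →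
    (switched a r S).SameCycle v w

theorem IsJoined.mk_switched_mem (h : IsJoined a r M N S) (hw : (w : G ⧸ zpowers a) ∈ N) :
    (switched a r S w : G ⧸ zpowers a) ∈ N := by
  by_cases hS : (w : G ⧸ zpowers r) ∈ S
  · rw [switched_of_mem hS, mk_mul_self]
    exact h.mk_mem _ (by rwa [mk_mul_self])
  · rwa [switched_of_notMem hS, mk_mul_self]

theorem IsJoined.sameCycle_of_forall [Finite G] (h : IsJoined a r M N S) {F : Perm G}
    (hF : ∀ w : G, (w : G ⧸ zpowers a) ∈ N → F.SameCycle w (switched a r S w))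
    (hv : v ∉ M) (hw : w ∉ M) (hvN : (v : G ⧸ zpowers a) ∈ N)
    (hwN : (w : G ⧸ zpowers a) ∈ N) : F.SameCycle v w := by
  obtain ⟨k, rfl⟩ := (h.sameCycle v w hv hw hvN hwN).exists_nat_pow_eq
  suffices ∀ k : ℕ, ((switched a r S ^ k) v : G ⧸ zpowers a) ∈ N ∧
      F.SameCycle v ((switched a r S ^ k) v) from (this k).2
  intro k
  induction k with
  | zero => exact ⟨hvN, SameCycle.refl _ _⟩
  | succ k ih =>
    rw [pow_succ', Perm.mul_apply]
    exact ⟨h.mk_switched_mem ih.1, ih.2.trans (hF _ ih.1)⟩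

/-- The cosets of `⟨a⟩` through the three elements of a coset of `⟨r⟩`, where `r` has order
three. -/
def IsTriple (a r : G) (p p' p'' : G ⧸ zpowers a) : Prop :=
  ∃ x : G, p = x ∧ p' = (x * r : G) ∧ p'' = (x * r⁻¹ : G)

theorem mul_self_eq_inv_of_pow_three (hr : r ^ 3 = 1) : r * r = r⁻¹ :=
  eq_inv_of_mul_eq_one_left (by rw [← pow_two, ← pow_succ, hr])

theorem IsTriple.rotate {p p' p'' : G ⧸ zpowers a}
    (h : IsTriple a r p p' p'') (hr : r ^ 3 = 1) : IsTriple a r p' p'' p := by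
  obtain ⟨x, rfl, rfl, rfl⟩ := h
  exact ⟨x * r, rfl, by rw [mul_assoc, mul_self_eq_inv_of_pow_three hr],
    by rw [mul_inv_cancel_right]⟩

theorem switched_insert_apply_self :
    switched a r (insert (x : G ⧸ zpowers r) S) x = x * r * a :=
  switched_of_mem (Set.mem_insert _ _)

theorem switched_insert_apply_mul (hr : r ^ 3 = 1) :
    switched a r (insert (x : G ⧸ zpowers r) S) (x * r) = x * r⁻¹ * a := by
  rw [switched_of_mem (.inl (mk_mul_self _ _)), mul_assoc x r r, mul_self_eq_inv_of_pow_three hr]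

theorem switched_insert_apply_mul_inv :
    switched a r (insert (x : G ⧸ zpowers r) S) (x * r⁻¹) = x * a := by
  rw [switched_of_mem (.inl (mk_mul_inv_self _ _)), inv_mul_cancel_right]

theorem switched_insert_apply_of_ne (hr : r ^ 3 = 1) (h₁ : w ≠ x) (h₂ : w ≠ x * r)
    (h₃ : w ≠ x * r⁻¹) :
    switched a r (insert (x : G ⧸ zpowers r) S) w = switched a r S w := by
  have hwx : (w : G ⧸ zpowers r) ≠ x := by
    rw [Ne, mk_zpowers_eq_iff_of_pow_three hr]; tauto
  by_cases hw : (w : G ⧸ zpowers r) ∈ S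
  · rw [switched_of_mem (.inr hw), switched_of_mem hw]
  · rw [switched_of_notMem (not_or.2 ⟨hwx, hw⟩), switched_of_notMem hw]

theorem switched_insert_sameCycle [Finite G] (hr : r ^ 3 = 1)
    (hx' : (x : G ⧸ zpowers a) ≠ (x * r : G)) (hx'' : (x : G ⧸ zpowers a) ≠ (x * r⁻¹ : G))
    (hne : ((x * r : G) : G ⧸ zpowers a) ≠ (x * r⁻¹ : G))
    (hS' : ∀ w : G, (w : G ⧸ zpowers a) = (x * r : G) → (w : G ⧸ zpowers r) ∉ S)
    (hS'' : ∀ w : G, (w : G ⧸ zpowers a) = (x * r⁻¹ : G) → (w : G ⧸ zpowers r) ∉ S)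
    (hw : (w : G ⧸ zpowers a) = (x * r : G) ∨ (w : G ⧸ zpowers a) = (x * r⁻¹ : G)) :
    (switched a r (insert (x : G ⧸ zpowers r) S)).SameCycle w x := by
  -- `F` maps `x` to `x r a`, then `x r` to `x r⁻¹ a`, and `x r⁻¹` to `x a`: the cosets of `x r` and
  -- `x r⁻¹` modulo `⟨a⟩` are inserted between `x` and `x a`.
  set F := switched a r (insert (x : G ⧸ zpowers r) S)
  have hF : ∀ w : G, (w : G ⧸ zpowers r) ∉ S → w ≠ x → w ≠ x * r → w ≠ x * r⁻¹ → F w = w * a :=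
    fun w hw h h' h'' => (switched_insert_apply_of_ne hr h h' h'').trans (switched_of_notMem hw)
  have hnew' : ∀ w : G, (w : G ⧸ zpowers a) = (x * r : G) → F.SameCycle w (x * r) :=
    fun w => sameCycle_of_forall_mk_eq fun w hw hwp => hF w (hS' w hw)
      (by rintro rfl; exact hx' hw) hwp (by rintro rfl; exact hne hw.symm)
  have hnew'' : ∀ w : G, (w : G ⧸ zpowers a) = (x * r⁻¹ : G) → F.SameCycle w (x * r⁻¹) :=
    fun w => sameCycle_of_forall_mk_eq fun w hw hwp => hF w (hS'' w hw)
      (by rintro rfl; exact hx'' hw) (by rintro rfl; exact hne hw) hwp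
  have hxr : F.SameCycle (x * r) x := by
    rw [← sameCycle_apply_right, switched_insert_apply_self]
    exact (hnew' _ (mk_mul_self _ _)).symm
  have hxr' : F.SameCycle (x * r⁻¹) x := by
    refine .trans (.symm ?_) hxr
    rw [← sameCycle_apply_left, switched_insert_apply_mul hr]
    exact hnew'' _ (mk_mul_self _ _)
  exact hw.elim (fun h => (hnew' w h).trans hxr) (fun h => (hnew'' w h).trans hxr')

theorem IsJoined.exists_insert [Finite G] (h : IsJoined a r M N S) (hr : r ^ 3 = 1)
    {p p' p'' : G ⧸ zpowers a} (ht : IsTriple a r p p' p'') (hp : p ∈ N) (hp' : p' ∉ N)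
    (hp'' : p'' ∉ N) (hne : p' ≠ p'') : ∃ S', IsJoined a r M (insert p' (insert p'' N)) S' := by
  obtain ⟨x, rfl, rfl, rfl⟩ := ht
  have hxS : (x : G ⧸ zpowers r) ∉ S := fun hx => hp' (h.mk_mem _ (by rwa [mk_mul_self]))
  have hxM : x ∉ M := fun hx => hxS (h.switched_mem x hx)
  set F := switched a r (insert (x : G ⧸ zpowers r) S)
  have hnew : ∀ w : G, (w : G ⧸ zpowers a) = (x * r : G) ∨ (w : G ⧸ zpowers a) = (x * r⁻¹ : G) →
      F.SameCycle w x := fun w =>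
    switched_insert_sameCycle hr (fun h' => hp' (h' ▸ hp)) (fun h' => hp'' (h' ▸ hp)) hne
      (fun w hw hS => hp' (hw ▸ h.mk_mem w hS)) (fun w hw hS => hp'' (hw ▸ h.mk_mem w hS))
  have hold : ∀ w : G, (w : G ⧸ zpowers a) ∈ N → F.SameCycle w (switched a r S w) := by
    intro w hw
    obtain rfl | hwx := eq_or_ne w x
    · rw [switched_of_notMem hxS, ← switched_insert_apply_mul_inv, sameCycle_apply_right]
      exact (hnew _ (.inr rfl)).symm
    · rw [← switched_insert_apply_of_ne hr hwx (by rintro rfl; exact hp' hw)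
        (by rintro rfl; exact hp'' hw), sameCycle_apply_right]
  have hmain : ∀ w : G, w ∉ M → (w : G ⧸ zpowers a) ∈
      insert ((x * r : G) : G ⧸ zpowers a) (insert ((x * r⁻¹ : G) : G ⧸ zpowers a) N) →
      F.SameCycle w x := by
    rintro w hw (h' | h' | h')
    exacts [hnew w (.inl h'), hnew w (.inr h'), h.sameCycle_of_forall hold hw hxM h' hp]
  refine ⟨_, ?_, fun w hw => .inr (h.switched_mem w hw), fun v w hv hw hvN hwN =>
    (hmain v hv hvN).trans (hmain w hw hwN).symm⟩
  rintro w (hw | hw)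
  · obtain rfl | rfl | rfl := (mk_zpowers_eq_iff_of_pow_three hr).1 hw
    exacts [.inr (.inr hp), .inl rfl, .inr (.inl rfl)]
  · exact .inr (.inr (h.mk_mem w hw))

/-- The cosets of `⟨a⟩` through the elements `z` and `z * r⁻¹`, for `z` in `⟨r * a⟩`, are pairwise
distinct. Two consecutive ones among the former are linked, by a triple, through one of the
latter. -/
structure IsRing (a r : G) : Prop where
  mk_injOn : Set.InjOn (fun z : G => (z : G ⧸ zpowers a)) (zpowers (r * a))
  mk_mul_inv_injOn : Set.InjOn (fun z : G => ((z * r⁻¹ : G) : G ⧸ zpowers a)) (zpowers (r * a))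
  mk_ne_mk_mul_inv : ∀ y ∈ zpowers (r * a), ∀ z ∈ zpowers (r * a),
    (y : G ⧸ zpowers a) ≠ (z * r⁻¹ : G)

/-- The cosets of `⟨a⟩` in the ring. -/
def ringCosets (a r : G) : Set (G ⧸ zpowers a) :=
  {p | ∃ z ∈ zpowers (r * a), p = z ∨ p = (z * r⁻¹ : G)}

/-- The cosets of `⟨r⟩` through the elements of `⟨r * a⟩`. -/
def ringTriples (a r : G) : Set (G ⧸ zpowers r) :=
  (fun z : G => (z : G ⧸ zpowers r)) '' zpowers (r * a)

theorem IsRing.ne_one (h : IsRing a r) : a ≠ 1 := by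
  rintro rfl
  exact h.mk_ne_mk_mul_inv r⁻¹ (by simp) 1 (one_mem _) (by simp)

theorem mk_mem_ringTriples (hr : r ^ 3 = 1) :
    (w : G ⧸ zpowers r) ∈ ringTriples a r ↔
      ∃ z ∈ zpowers (r * a), w = z ∨ w = z * r ∨ w = z * r⁻¹ := by
  simp only [ringTriples, Set.mem_image, SetLike.mem_coe, ← mk_zpowers_eq_iff_of_pow_three hr,
    eq_comm]

theorem mk_mul_inv_mem_ringTriples {z : G} (hz : z ∈ zpowers (r * a)) :
    (z * a⁻¹ : G ⧸ zpowers r) ∈ ringTriples a r :=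
  ⟨z * (r * a)⁻¹, mul_mem hz (inv_mem (mem_zpowers _)), by
    rw [mul_inv_rev, ← mul_assoc]; exact mk_mul_inv_self r _⟩

theorem IsRing.eq_or_eq_of_mk_eq (h : IsRing a r) (hr : r ^ 3 = 1) {z : G}
    (hz : z ∈ zpowers (r * a)) (hwz : (w : G ⧸ zpowers a) = z)
    (hw : (w : G ⧸ zpowers r) ∈ ringTriples a r) : w = z ∨ w = z * a⁻¹ := by
  obtain ⟨y, hy, rfl | rfl | rfl⟩ := (mk_mem_ringTriples hr).1 hw
  · exact .inl (h.mk_injOn hy hz hwz)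
  · rw [← mk_mul_self, mul_assoc] at hwz
    rw [← h.mk_injOn (mul_mem hy (mem_zpowers _)) hz hwz]
    exact .inr (by group)
  · exact absurd hwz.symm (h.mk_ne_mk_mul_inv _ hz _ hy)

theorem IsRing.eq_of_mk_eq_mk_mul_inv (h : IsRing a r) (hr : r ^ 3 = 1) {z : G}
    (hz : z ∈ zpowers (r * a)) (hwz : (w : G ⧸ zpowers a) = (z * r⁻¹ : G))
    (hw : (w : G ⧸ zpowers r) ∈ ringTriples a r) : w = z * r⁻¹ := by
  obtain ⟨y, hy, rfl | rfl | rfl⟩ := (mk_mem_ringTriples hr).1 hw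
  · exact absurd hwz (h.mk_ne_mk_mul_inv _ hy _ hz)
  · rw [← mk_mul_self, mul_assoc] at hwz
    exact absurd hwz (h.mk_ne_mk_mul_inv _ (mul_mem hy (mem_zpowers _)) _ hz)
  · rw [h.mk_mul_inv_injOn hy hz hwz]

theorem IsRing.sameCycle_mul_inv [Finite G] (h : IsRing a r) (hr : r ^ 3 = 1) {z : G}
    (hz : z ∈ zpowers (r * a)) (hwz : (w : G ⧸ zpowers a) = z) (hne : w ≠ z) :
    (switched a r (ringTriples a r)).SameCycle w (z * a⁻¹) := by
  obtain ⟨k, hk⟩ := mem_powers_iff_mem_zpowers.2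
    (QuotientGroup.eq.1 (hwz.trans (mk_mul_inv_self a z).symm))
  replace hk : w * a ^ k = z * a⁻¹ := eq_inv_mul_iff_mul_eq.1 hk
  induction k generalizing w with
  | zero => rw [← hk, pow_zero, mul_one]
  | succ k ih =>
    by_cases hwa : w = z * a⁻¹
    · rw [hwa]
    · have hw : (w : G ⧸ zpowers r) ∉ ringTriples a r := fun hw =>
        (h.eq_or_eq_of_mk_eq hr hz hwz hw).elim hne hwa
      rw [← sameCycle_apply_left, switched_of_notMem hw]
      exact ih ((mk_mul_self a w).trans hwz) (by rwa [Ne, ← eq_mul_inv_iff_mul_eq])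
        (by rw [mul_assoc, ← pow_succ', hk])

theorem IsRing.sameCycle_mul_inv_of_mk_eq_mk_mul_inv [Finite G] (h : IsRing a r) (hr : r ^ 3 = 1)
    {z : G} (hz : z ∈ zpowers (r * a)) (hwz : (w : G ⧸ zpowers a) = (z * r⁻¹ : G)) :
    (switched a r (ringTriples a r)).SameCycle w (z * a⁻¹) := by
  have hw : (switched a r (ringTriples a r)).SameCycle w (z * r⁻¹) :=
    sameCycle_of_forall_mk_eq (fun v hv hne => switched_of_notMem fun hS =>
      hne (h.eq_of_mk_eq_mk_mul_inv hr hz hv hS)) hwz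
  have hmem : ((z * r⁻¹ : G) : G ⧸ zpowers r) ∈ ringTriples a r := by
    rw [mk_mul_inv_self]; exact ⟨z, hz, rfl⟩
  refine hw.trans ?_
  rw [← sameCycle_apply_left, switched_of_mem hmem, inv_mul_cancel_right]
  exact h.sameCycle_mul_inv hr hz (mk_mul_self a z) (by simpa using h.ne_one)

theorem IsRing.sameCycle_inv [Finite G] (h : IsRing a r) (hr : r ^ 3 = 1) {z : G}
    (hz : z ∈ zpowers (r * a)) :
    (switched a r (ringTriples a r)).SameCycle (z * a⁻¹) a⁻¹ := by
  obtain ⟨k, rfl⟩ := mem_powers_iff_mem_zpowers.2 hz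
  dsimp only at hz ⊢
  clear hz
  induction k with
  | zero => rw [pow_zero, one_mul]
  | succ k ih =>
    have hk : (r * a) ^ k ∈ zpowers (r * a) := pow_mem (mem_zpowers _) k
    have happly : switched a r (ringTriples a r) ((r * a) ^ (k + 1) * a⁻¹) =
        (r * a) ^ k * r⁻¹ * a := by
      rw [switched_of_mem (mk_mul_inv_mem_ringTriples (pow_mem (mem_zpowers _) _)),
        ← mul_self_eq_inv_of_pow_three hr, pow_succ]
      group
    refine .trans ?_ ih
    rw [← sameCycle_apply_left, happly]
    exact h.sameCycle_mul_inv_of_mk_eq_mk_mul_inv hr hk (mk_mul_self a _)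

theorem IsRing.isJoined [Finite G] (h : IsRing a r) (hr : r ^ 3 = 1) :
    IsJoined a r (zpowers (r * a)) (ringCosets a r) (ringTriples a r) := by
  have hmain : ∀ w : G, w ∉ zpowers (r * a) → (w : G ⧸ zpowers a) ∈ ringCosets a r →
      (switched a r (ringTriples a r)).SameCycle w a⁻¹ := by
    rintro w hw ⟨z, hz, hwz | hwz⟩
    · exact (h.sameCycle_mul_inv hr hz hwz (by rintro rfl; exact hw hz)).trans
        (h.sameCycle_inv hr hz)
    · exact (h.sameCycle_mul_inv_of_mk_eq_mk_mul_inv hr hz hwz).trans (h.sameCycle_inv hr hz)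
  refine ⟨fun w hw => ?_, fun w hw => ⟨w, hw, rfl⟩, fun v w hv hw hvN hwN =>
    (hmain v hv hvN).trans (hmain w hw hwN).symm⟩
  obtain ⟨z, hz, rfl | rfl | rfl⟩ := (mk_mem_ringTriples hr).1 hw
  · exact ⟨w, hz, .inl rfl⟩
  · exact ⟨z * (r * a), mul_mem hz (mem_zpowers _), .inl (by rw [← mul_assoc, mk_mul_self])⟩
  · exact ⟨z, hz, .inr rfl⟩

end Switching

section Growth

variable {V W : Type*} {E : V → V → V → Prop} {E' : W → W → W → Prop} {A B C L : Set V}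

/-- `B` arises from `A` by adjoining the two last vertices of an `E`-triple whose first vertex lies
in `A`. -/
def GrowStep (E : V → V → V → Prop) (A B : Set V) : Prop :=
  ∃ p p' p'', E p p' p'' ∧ p ∈ A ∧ p' ∉ A ∧ p'' ∉ A ∧ p' ≠ p'' ∧ B = insert p' (insert p'' A)

/-- `B` arises from `A` by successively adjoining `E`-triples, each of which meets what has been
built so far in exactly its first vertex. -/
def Grows (E : V → V → V → Prop) : Set V → Set V → Prop :=
  Relation.ReflTransGen (GrowStep E)

theorem GrowStep.subset (h : GrowStep E A B) : A ⊆ B := by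
  obtain ⟨p, p', p'', -, -, -, -, -, rfl⟩ := h
  exact (Set.subset_insert _ _).trans (Set.subset_insert _ _)

theorem GrowStep.union_left (h : GrowStep E A B) (hL : L ∩ B ⊆ A) :
    GrowStep E (L ∪ A) (L ∪ B) := by
  obtain ⟨p, p', p'', hE, hp, hp', hp'', hne, rfl⟩ := h
  refine ⟨p, p', p'', hE, .inr hp, not_or.2 ⟨fun h => hp' (hL ⟨h, .inl rfl⟩), hp'⟩,
    not_or.2 ⟨fun h => hp'' (hL ⟨h, .inr (.inl rfl)⟩), hp''⟩, hne, ?_⟩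
  rw [Set.union_insert, Set.union_insert]

theorem Grows.subset (h : Grows E A B) : A ⊆ B := by
  induction h with
  | refl => exact subset_rfl
  | tail _ hstep ih => exact ih.trans hstep.subset

theorem Grows.trans (h : Grows E A B) (h' : Grows E B C) : Grows E A C :=
  Relation.ReflTransGen.trans h h'

theorem Grows.of_triple {p p' p'' : V} (hE : E p p' p'') (hp : p ∈ A) (hp' : p' ∉ A)
    (hp'' : p'' ∉ A) (hne : p' ≠ p'') (hB : B = insert p' (insert p'' A)) : Grows E A B :=
  .single ⟨p, p', p'', hE, hp, hp', hp'', hne, hB⟩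

theorem Grows.union_left (h : Grows E A B) (hL : L ∩ B ⊆ A) : Grows E (L ∪ A) (L ∪ B) := by
  induction h with
  | refl => exact .refl
  | tail hAB hstep ih =>
    have hL' := (Set.inter_subset_inter_right L hstep.subset).trans hL
    exact (ih hL').tail (hstep.union_left (hL.trans (Grows.subset hAB)))

theorem Grows.image {f : V → W} (h : Grows E A B) (hf : Set.InjOn f B)
    (hE : ∀ p ∈ B, ∀ p' ∈ B, ∀ p'' ∈ B, E p p' p'' → E' (f p) (f p') (f p'')) :
    Grows E' (f '' A) (f '' B) := by
  induction h with
  | refl => exact .refl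
  | @tail B C _ hstep ih =>
    have hBC := hstep.subset
    refine (ih (hf.mono hBC) fun p hp p' hp' p'' hp'' =>
      hE p (hBC hp) p' (hBC hp') p'' (hBC hp'')).trans ?_
    obtain ⟨p, p', p'', h, hp, hp', hp'', hne, rfl⟩ := hstep
    have hmem' : p' ∈ insert p' (insert p'' B) := .inl rfl
    have hmem'' : p'' ∈ insert p' (insert p'' B) := .inr (.inl rfl)
    rw [Set.image_insert_eq, Set.image_insert_eq]
    exact .of_triple (hE p (hBC hp) p' hmem' p'' hmem'' h) (Set.mem_image_of_mem f hp)
      (fun h => hp' ((hf.mem_image_iff hBC hmem').1 h))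
      (fun h => hp'' ((hf.mem_image_iff hBC hmem'').1 h)) (fun h => hne (hf hmem' hmem'' h)) rfl

theorem IsJoined.exists_of_grows {G : Type*} [Group G] [Finite G] {a r : G} {M : Set G}
    {N N' : Set (G ⧸ zpowers a)} {S : Set (G ⧸ zpowers r)} (h : IsJoined a r M N S)
    (hr : r ^ 3 = 1) (hgrows : Grows (IsTriple a r) N N') : ∃ S', IsJoined a r M N' S' := by
  induction hgrows with
  | refl => exact ⟨S, h⟩
  | tail _ hstep ih =>
    obtain ⟨S', hS'⟩ := ih
    obtain ⟨p, p', p'', htriple, hp, hp', hp'', hne, rfl⟩ := hstep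
    exact hS'.exists_insert hr htriple hp hp' hp'' hne

end Growth

section Labels

variable {A : Type*} [Group A] {c d : A} {q : ℕ}

/-- The triples of labels. The label `(y, i)` stands for the coset of `⟨a⟩` described in
`labelCoset` below. -/
inductive LabelTriple (c d : A) (q : ℕ) : A × ℕ → A × ℕ → A × ℕ → Prop
  | chain (y : A) {i : ℕ} (hi : Odd i) (hiq : i ≤ q) :
    LabelTriple c d q (y, i + 2) (y, i + 1) (y, i)
  | ring (y : A) : LabelTriple c d q (y, 0) (y * c, 0) (y, q + 1)
  | link (y : A) :
    LabelTriple c d q (y * d * c⁻¹ * c⁻¹, q) (y * d * c⁻¹, q + 1) (y, q + 2)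
  | rotate {p p' p'' : A × ℕ} (h : LabelTriple c d q p p' p'') : LabelTriple c d q p' p'' p

theorem grows_column_of_odd (y : A) {k : ℕ} (hk : 2 * k + 1 ≤ q + 2) :
    Grows (LabelTriple c d q) ({y} ×ˢ Set.Icc (2 * k + 1) (q + 2)) ({y} ×ˢ Set.Icc 1 (q + 2)) := by
  induction k with
  | zero => exact .refl
  | succ k ih =>
    exact .trans (.of_triple (.chain y ⟨k, rfl⟩ (by omega)) (by grind) (by grind) (by grind)
      (by grind) (by ext ⟨z, i⟩; grind)) (ih (by omega))

theorem grows_column (hq : Odd q) (y : A) {i : ℕ} (hi : i = q ∨ i = q + 1) :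
    Grows (LabelTriple c d q) {(y, i)} ({y} ×ˢ Set.Icc 1 (q + 2)) := by
  obtain ⟨k, rfl⟩ := hq
  refine .trans ?_ (grows_column_of_odd y (k := k) (by omega))
  have htriple := LabelTriple.chain (c := c) (d := d) y ⟨k, rfl⟩ le_rfl
  rcases hi with rfl | rfl
  · exact .of_triple htriple.rotate.rotate (Set.mem_singleton _) (by simp) (by simp) (by simp)
      (by ext ⟨z, i⟩; grind)
  · exact .of_triple htriple.rotate (Set.mem_singleton _) (by simp) (by simp) (by simp)
      (by ext ⟨z, i⟩; grind)

theorem grows_columns [Finite A] (hq : Odd q) (Y : Set A) {f : A → ℕ}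
    (hf : ∀ y, f y = q ∨ f y = q + 1) :
    Grows (LabelTriple c d q) (Y.graphOn f) (Y ×ˢ Set.Icc 1 (q + 2)) := by
  induction Y, Y.toFinite using Set.Finite.induction_on with
  | empty => rw [Set.graphOn_empty, Set.empty_prod]; exact .refl
  | @insert y Y hy _ ih =>
    rw [Set.graphOn_insert, ← Set.singleton_union, ← Set.singleton_union, Set.union_prod]
    refine .trans (ih.union_left ?_) ?_
    · grind
    · rw [Set.union_comm _ (Y ×ˢ _), Set.union_comm _ (Y ×ˢ _)]
      exact (grows_column hq y (hf y)).union_left (by grind)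

theorem grows_of_graphOn [Finite A] (hq : Odd q) (Y : Set A) {f : A → ℕ}
    (hf : ∀ y, f y = q ∨ f y = q + 1) :
    Grows (LabelTriple c d q) (Y ×ˢ {0} ∪ Y.graphOn f) (Y ×ˢ Set.Iic (q + 2)) := by
  convert (grows_columns hq Y hf).union_left (L := Y ×ˢ {0}) (by grind) using 1
  ext ⟨y, i⟩; grind

theorem grows_ring_pow (hc : orderOf c = q + 2) (v : A) {t : ℕ} (ht : t ≤ q) :
    Grows (LabelTriple c d q) {(v, q + 1)}
      ((fun s : ℕ => (v * c ^ s, 0)) '' Set.Iic (t + 1) ∪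
        (fun s : ℕ => (v * c ^ s, q + 1)) '' Set.Iic t) := by
  have hIic : ∀ n : ℕ, Set.Iic (n + 1) = insert (n + 1) (Set.Iic n) := Order.Iic_succ
  have hstep : ∀ t, LabelTriple c d q (v * c ^ t, 0) (v * c ^ (t + 1), 0) (v * c ^ t, q + 1) :=
    fun t => by rw [pow_succ, ← mul_assoc]; exact .ring _
  have hne : ∀ s ≤ q + 1, ∀ t < s, c ^ t ≠ c ^ s := fun s hs t ht h =>
    ht.ne (pow_injOn_Iio_orderOf (by grind) (by grind) h)
  induction t with
  | zero =>
    refine .of_triple (hstep 0).rotate.rotate (by simp) (by simp) (by simp)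
      (by simpa using (hne 1 (by omega) 0 one_pos).symm) ?_
    have hIic0 : Set.Iic 0 = {0} := Set.Iic_bot
    simp only [hIic, hIic0, Set.image_insert_eq, Set.image_singleton, pow_zero, mul_one,
      Set.insert_union, Set.singleton_union]
    exact Set.insert_comm _ _ _
  | succ t ih =>
    refine (ih (by omega)).trans (.of_triple (hstep (t + 1))
      (.inl ⟨t + 1, Set.mem_Iic.2 le_rfl, rfl⟩)
      (by simpa using fun s hs => hne (t + 2) (by omega) s (by omega))
      (by simpa using fun s hs => hne (t + 1) (by omega) s (by omega)) (by simp) ?_)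
    have hIic' := congr_arg (fun I => (fun s : ℕ => (v * c ^ s, q + 1)) '' I) (hIic t)
    rw [hIic (t + 1), hIic', Set.image_insert_eq, Set.image_insert_eq, Set.insert_union,
      Set.union_insert]

theorem image_mul_pow_Iic [Finite A] {k : ℕ} (hc : orderOf c = k + 1) (v : A) :
    (fun s : ℕ => v * c ^ s) '' Set.Iic k = {y | v⁻¹ * y ∈ zpowers c} := by
  classical
  ext y
  rw [Set.mem_ofPred_eq, ← mem_powers_iff_mem_zpowers, mem_powers_iff_mem_range_orderOf, hc]
  simp [eq_inv_mul_iff_mul_eq]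

theorem grows_ring [Finite A] (hc : orderOf c = q + 2) (v : A) :
    Grows (LabelTriple c d q) {(v, q + 1)}
      ({y | v⁻¹ * y ∈ zpowers c} ×ˢ {0} ∪
        ({y | v⁻¹ * y ∈ zpowers c} \ {v * c⁻¹}) ×ˢ {q + 1}) := by
  convert grows_ring_pow (d := d) hc v le_rfl using 2
  · rw [← image_mul_pow_Iic hc v, Set.prod_singleton, Set.image_image]
  · have hlast : c ^ (q + 1) = c⁻¹ :=
      eq_inv_of_mul_eq_one_left (by rw [← pow_succ, ← hc, pow_orderOf_eq_one])
    have hIic : Set.Iic (q + 1) = insert (q + 1) (Set.Iic q) := Order.Iic_succ q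
    rw [← image_mul_pow_Iic hc v, hIic, Set.image_insert_eq, hlast, Set.insert_sdiff_self_of_notMem,
      Set.prod_singleton, Set.image_image]
    rintro ⟨t, ht, h⟩
    rw [← hlast, mul_right_inj] at h
    exact absurd (pow_injOn_Iio_orderOf (by grind) (by grind) h) (by grind)

theorem grows_coset [Finite A] (hq : Odd q) (hc : orderOf c = q + 2) {X : Set A}
    (hX : ∀ y ∈ X, ∀ g ∈ zpowers c, y * g ∈ X) {v : A} (hv : v ∉ X) (hvX : v * c * d⁻¹ ∈ X) :
    Grows (LabelTriple c d q) (X ×ˢ Set.Iic (q + 2))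
      ((X ∪ {y | v⁻¹ * y ∈ zpowers c}) ×ˢ Set.Iic (q + 2)) := by
  classical
  have hq0 : q ≠ 0 := by rintro rfl; simp at hq
  have hdisj : ∀ z, v⁻¹ * z ∈ zpowers c → z ∉ X := fun z hz h =>
    hv (by simpa using hX z h _ (inv_mem hz))
  have hlink : Grows (LabelTriple c d q) (X ×ˢ Set.Iic (q + 2))
      (insert (v * c⁻¹, q) (X ×ˢ Set.Iic (q + 2)) ∪ {(v, q + 1)}) := by
    have htriple := (LabelTriple.link (c := c) (d := d) (q := q) (v * c * d⁻¹)).rotate.rotate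
    simp only [inv_mul_cancel_right, mul_inv_cancel_right] at htriple
    refine .of_triple htriple ⟨hvX, Set.mem_Iic.2 le_rfl⟩ (fun h => hdisj _ (by simp) h.1)
      (fun h => hv h.1) (by simp) ?_
    rw [Set.union_singleton, Set.insert_comm]
  have hring := (grows_ring (d := d) hc v).union_left
    (L := insert (v * c⁻¹, q) (X ×ˢ Set.Iic (q + 2))) <| by
      rintro ⟨y, i⟩ ⟨h | h, h' | h'⟩
      · simp_all
      · simp_all
      · exact absurd h.1 (hdisj y h'.1)
      · exact absurd h.1 (hdisj y h'.1.1)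
  have hcols := (grows_of_graphOn (c := c) (d := d) hq {y | v⁻¹ * y ∈ zpowers c}
    (f := fun y => if y = v * c⁻¹ then q else q + 1) (by grind)).union_left
    (L := X ×ˢ Set.Iic (q + 2)) fun z hz => absurd hz.1.1 (hdisj _ hz.2.1)
  have hgraph : {y | v⁻¹ * y ∈ zpowers c}.graphOn (fun y => if y = v * c⁻¹ then q else q + 1) =
      insert (v * c⁻¹, q) (({y | v⁻¹ * y ∈ zpowers c} \ {v * c⁻¹}) ×ˢ {q + 1}) := by
    ext ⟨y, i⟩
    by_cases hy : y = v * c⁻¹ <;> simp [hy, eq_comm]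
  rw [hgraph, Set.union_insert, Set.union_insert, ← Set.insert_union, ← Set.union_prod] at hcols
  exact hlink.trans (hring.trans hcols)

theorem closure_subset_of_mul_mem [Finite A] {s X : Set A} (h1 : 1 ∈ X)
    (hX : ∀ y ∈ X, ∀ g ∈ s, y * g ∈ X) : (Subgroup.closure s : Set A) ⊆ X := by
  intro y hy
  rw [SetLike.mem_coe, ← Subgroup.mem_toSubmonoid, Subgroup.closure_toSubmonoid_of_finite] at hy
  induction hy using Submonoid.closure_induction_right with
  | one => exact h1
  | mul_right y _ g hg ih => exact hX y ih g hg

theorem grows_closure [Finite A] (hq : Odd q) (hc : orderOf c = q + 2) :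
    Grows (LabelTriple c d q) ((zpowers c : Set A) ×ˢ {0, q + 1})
      ((Subgroup.closure {c, d} : Set A) ×ˢ Set.Iic (q + 2)) := by
  have hc_mem : c ∈ Subgroup.closure {c, d} := Subgroup.subset_closure (.inl rfl)
  have hd_mem : d ∈ Subgroup.closure {c, d} := Subgroup.subset_closure (.inr rfl)
  have hzpowers : zpowers c ≤ Subgroup.closure {c, d} := Subgroup.zpowers_le.2 hc_mem
  have hbase : Grows (LabelTriple c d q) ((zpowers c : Set A) ×ˢ {0, q + 1})
      ((zpowers c : Set A) ×ˢ Set.Iic (q + 2)) := by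
    have h := grows_of_graphOn (c := c) (d := d) hq (zpowers c : Set A) (f := fun _ => q + 1)
      fun _ => .inr rfl
    convert h using 1
    ext ⟨y, i⟩
    by_cases hy : y ∈ zpowers c <;> simp [hy, eq_comm]
  obtain ⟨X, ⟨hXgrows, hXmul, hXle⟩, hXmax⟩ := Set.Finite.exists_maximal
    (s := {X : Set A | Grows (LabelTriple c d q) ((zpowers c : Set A) ×ˢ {0, q + 1})
      (X ×ˢ Set.Iic (q + 2)) ∧ (∀ y ∈ X, ∀ g ∈ zpowers c, y * g ∈ X) ∧
      X ⊆ Subgroup.closure {c, d}}) (Set.toFinite _)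
    ⟨zpowers c, hbase, fun y hy g hg => mul_mem hy hg, hzpowers⟩
  have hlink : ∀ v, v * c * d⁻¹ ∈ X → v ∈ X := by
    intro v hvX
    by_contra hv
    have hv_mem : v ∈ Subgroup.closure {c, d} := by
      rw [← inv_mul_cancel_right v c⁻¹, inv_inv, ← inv_mul_cancel_right (v * c) d]
      exact mul_mem (mul_mem (hXle hvX) hd_mem) (inv_mem hc_mem)
    refine hv (hXmax ⟨hXgrows.trans (grows_coset hq hc hXmul hv hvX), ?_, ?_⟩
      Set.subset_union_left (.inr (by simp)))
    · rintro y (hy | hy) g hg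
      · exact .inl (hXmul y hy g hg)
      · exact .inr (by simpa [← mul_assoc] using mul_mem hy hg)
    · rintro y (hy | hy)
      · exact hXle hy
      · simpa using mul_mem hv_mem (hzpowers hy)
  suffices X = Subgroup.closure {c, d} from this ▸ hXgrows
  have h1 : 1 ∈ X := (hXgrows.subset ⟨one_mem (zpowers c), .inl rfl⟩ : (1, 0) ∈ X ×ˢ _).1
  refine hXle.antisymm (closure_subset_of_mul_mem h1 ?_)
  rintro y hy g (rfl | rfl)
  · exact hXmul y hy _ (mem_zpowers _)
  · have h := hXmul _ (hlink (y * g * c⁻¹) (by simpa using hy)) c (mem_zpowers c)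
    rwa [inv_mul_cancel_right] at h

end Labels

section FirstLetters

variable {k n : ℕ}

/-- The extension of a permutation of the first `k` letters which fixes the remaining ones. -/
noncomputable def firstLetters (h : k ≤ n) : Perm (Fin k) →* Perm (Fin n) :=
  viaEmbeddingHom (Fin.castLEEmb h)

theorem firstLetters_castLE (h : k ≤ n) (g : Perm (Fin k)) (i : Fin k) :
    firstLetters h g (i.castLE h) = (g i).castLE h :=
  viaEmbedding_apply g (Fin.castLEEmb h) i

theorem firstLetters_of_le (h : k ≤ n) (g : Perm (Fin k)) {i : Fin n} (hi : k ≤ (i : ℕ)) :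
    firstLetters h g i = i := by
  refine viaEmbedding_apply_of_notMem g (Fin.castLEEmb h) i ?_
  rintro ⟨j, rfl⟩
  exact absurd j.2 (not_lt.2 hi)

theorem firstLetters_injective (h : k ≤ n) : Function.Injective (firstLetters h) :=
  viaEmbeddingHom_injective _

theorem firstLetters_eq (h : k ≤ n) {g : Perm (Fin k)} {e : Perm (Fin n)}
    (hlt : ∀ i : Fin k, e (i.castLE h) = (g i).castLE h)
    (hge : ∀ i : Fin n, k ≤ (i : ℕ) → e i = i) : firstLetters h g = e := by
  ext1 i
  obtain hi | hi := lt_or_ge (i : ℕ) k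
  · exact (firstLetters_castLE h g ⟨i, hi⟩).trans (hlt ⟨i, hi⟩).symm
  · rw [firstLetters_of_le h g hi, hge i hi]

theorem exists_firstLetters_eq (h : k ≤ n) {e : Perm (Fin n)}
    (he : ∀ i : Fin n, k ≤ (i : ℕ) → e i = i) : ∃ g, firstLetters h g = e := by
  have hlt : ∀ i : Fin k, (e (i.castLE h) : ℕ) < k := by
    intro i
    by_contra! hi
    exact hi.not_gt (by rw [e.injective (he _ hi)]; exact i.2)
  refine ⟨ofBijective (fun i => ⟨e (i.castLE h), hlt i⟩)
    (Finite.injective_iff_bijective.1 fun i j hij => ?_), firstLetters_eq h (fun i => rfl) he⟩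
  exact Fin.castLE_injective h (e.injective (Fin.ext (Fin.mk.inj_iff.1 hij)))

theorem sign_firstLetters (h : k ≤ n) (g : Perm (Fin k)) : sign (firstLetters h g) = sign g := by
  change sign (viaEmbedding g (Fin.castLEEmb h)) = sign g
  rw [viaEmbedding, sign_extendDomain]

theorem firstLetters_swap (h : k ≤ n) (i j : Fin k) :
    firstLetters h (swap i j) = swap (i.castLE h) (j.castLE h) := by
  refine firstLetters_eq h (fun l => ((Fin.castLE_injective h).map_swap i j l).symm) fun l hl => ?_
  refine swap_apply_of_ne_of_ne ?_ ?_ <;> rintro rfl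
  · exact absurd i.2 (not_lt.2 hl)
  · exact absurd j.2 (not_lt.2 hl)

theorem firstLetters_cycleRange (h : k ≤ n) (j : Fin k) :
    firstLetters h (Fin.cycleRange j) = Fin.cycleRange (j.castLE h) := by
  refine firstLetters_eq h (fun i => ?_) fun i hi =>
    Fin.cycleRange_of_gt (Fin.lt_def.2 (lt_of_lt_of_le j.2 hi))
  have : NeZero k := ⟨(i.pos).ne'⟩
  have : NeZero n := ⟨((i.castLE h).pos).ne'⟩
  obtain hij | rfl | hij := lt_trichotomy i j
  · apply Fin.ext
    have hij' : i.castLE h < j.castLE h := hij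
    rw [Fin.val_castLE, Fin.coe_cycleRange_of_lt hij, Fin.coe_cycleRange_of_lt hij',
      Fin.val_castLE]
  · rw [Fin.cycleRange_self, Fin.cycleRange_self]
    rfl
  · have hij' : j.castLE h < i.castLE h := hij
    rw [Fin.cycleRange_of_gt hij, Fin.cycleRange_of_gt hij']

theorem firstLetters_firstLetters {l : ℕ} (h : k ≤ l) (h' : l ≤ n) (g : Perm (Fin k)) :
    firstLetters h' (firstLetters h g) = firstLetters (h.trans h') g := by
  refine (firstLetters_eq _ (fun i => ?_) fun i hi => ?_).symm
  · exact (firstLetters_castLE h' _ (i.castLE h)).trans (by rw [firstLetters_castLE]; rfl)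
  · obtain hi' | hi' := lt_or_ge (i : ℕ) l
    · exact (firstLetters_castLE h' _ ⟨i, hi'⟩).trans (by rw [firstLetters_of_le h g hi]; rfl)
    · exact firstLetters_of_le h' _ hi'

end FirstLetters

section Letters

open scoped Fin.CommRing

variable {n : ℕ} [NeZero n]

theorem natCast_ne_zero_of_lt {k : ℕ} (hk : k ≠ 0) (hkn : k < n) : (k : Fin n) ≠ 0 := fun h =>
  hk (Nat.eq_zero_of_dvd_of_lt (Fin.natCast_eq_zero.1 h) hkn)

/-- Right multiplication by `rot n` moves the last letter of a word to the front. -/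
def rot (n : ℕ) : Perm (Fin n) := (finRotate n)⁻¹

theorem rot_apply (i : Fin n) : rot n i = i - 1 := by
  rw [rot, Perm.inv_eq_iff_eq, finRotate_apply, sub_add_cancel]

theorem rot_pow_apply (k : ℕ) (i : Fin n) : (rot n ^ k) i = i - k := by
  induction k with
  | zero => simp
  | succ k ih => rw [pow_succ', mul_apply, ih, rot_apply]; push_cast; ring

theorem sign_rot {n : ℕ} (hn : Odd n) : sign (rot n) = 1 := by
  rw [rot, sign_inv, sign_finRotate, (Nat.Odd.sub_odd hn odd_one).neg_one_pow]

theorem eq_one_of_mem_zpowers_rot {z : Perm (Fin n)} (hz : z ∈ zpowers (rot n)) {i : Fin n}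
    (hi : z i = i) : z = 1 := by
  obtain ⟨k, rfl⟩ := mem_powers_iff_mem_zpowers.2 hz
  dsimp only at hi ⊢
  rw [rot_pow_apply, sub_eq_self] at hi
  ext1 j
  rw [rot_pow_apply, hi, sub_zero, one_apply]

/-- The transposition of cyclically adjacent letters. -/
def adj (i : Fin n) : Perm (Fin n) := swap i (i + 1)

theorem adj_mul_self (i : Fin n) : adj i * adj i = 1 := swap_mul_self _ _

theorem adj_mul_rot (i : Fin n) : adj i * rot n = rot n * adj (i + 1) := by
  have h := swap_apply_apply (rot n) (i + 1) (i + 1 + 1)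
  rw [rot_apply, rot_apply, add_sub_cancel_right, add_sub_cancel_right] at h
  rw [adj, adj, h, inv_mul_cancel_right]

theorem adj_mul_rot_pow (i : Fin n) (k : ℕ) :
    adj i * rot n ^ k = rot n ^ k * adj (i + (k : Fin n)) := by
  induction k with
  | zero => simp
  | succ k ih => rw [pow_succ, ← mul_assoc, ih, mul_assoc, adj_mul_rot]; push_cast; group

/-- The cyclic shift of three cyclically adjacent letters. -/
def tri (i : Fin n) : Perm (Fin n) := adj i * adj (i + 1)

theorem tri_mul_rot_pow (i : Fin n) (k : ℕ) :
    tri i * rot n ^ k = rot n ^ k * tri (i + (k : Fin n)) := by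
  rw [tri, mul_assoc, adj_mul_rot_pow, ← mul_assoc, adj_mul_rot_pow, mul_assoc, tri,
    add_right_comm]

theorem tri_mul_tri (i : Fin n) : tri i * tri (i + 1) = adj i * adj (i + 1 + 1) := by
  rw [tri, tri, mul_assoc, ← mul_assoc (adj (i + 1)), adj_mul_self, one_mul]

theorem natCast_inj_of_lt {j k : ℕ} (hj : j < n) (hk : k < n) : (j : Fin n) = k ↔ j = k := by
  rw [Fin.ext_iff, Fin.val_cast_of_lt hj, Fin.val_cast_of_lt hk]

theorem add_one_ne_self (hn : 2 ≤ n) (i : Fin n) : i + 1 ≠ i := by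
  simpa using natCast_ne_zero_of_lt (n := n) one_ne_zero (by omega)

theorem add_two_ne_self (hn : 3 ≤ n) (i : Fin n) : i + 2 ≠ i := by
  simpa using natCast_ne_zero_of_lt (n := n) two_ne_zero (by omega)

theorem add_two_ne_add_one (hn : 2 ≤ n) (i : Fin n) : i + 2 ≠ i + 1 := by
  rw [← one_add_one_eq_two, ← add_assoc]
  exact add_one_ne_self hn _

theorem tri_eq (i : Fin n) : tri i = swap (i + 1) i * swap (i + 1) (i + 2) := by
  rw [tri, adj, adj, swap_comm, add_assoc, one_add_one_eq_two]

theorem tri_apply_self (hn : 3 ≤ n) (i : Fin n) : tri i i = i + 1 := by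
  rw [tri_eq, mul_apply, swap_apply_of_ne_of_ne (add_one_ne_self (by omega) i).symm
    (add_two_ne_self hn i).symm, swap_apply_right]

theorem tri_apply_add_one (hn : 3 ≤ n) (i : Fin n) : tri i (i + 1) = i + 2 := by
  rw [tri_eq, mul_apply, swap_apply_left, swap_apply_of_ne_of_ne
    (add_two_ne_add_one (by omega) i) (add_two_ne_self hn i)]

theorem tri_apply_add_two (i : Fin n) : tri i (i + 2) = i := by
  rw [tri_eq, mul_apply, swap_apply_right, swap_apply_left]

theorem tri_apply_of_ne {i j : Fin n} (h₀ : j ≠ i) (h₁ : j ≠ i + 1) (h₂ : j ≠ i + 2) :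
    tri i j = j := by
  rw [tri_eq, mul_apply, swap_apply_of_ne_of_ne h₁ h₂, swap_apply_of_ne_of_ne h₁ h₀]

theorem tri_natCast_apply_of_lt_or_lt {j k : ℕ} (hj : j + 2 < n) (hk : k < n)
    (h : k < j ∨ j + 2 < k) : tri (j : Fin n) k = k := by
  refine tri_apply_of_ne ?_ ?_ ?_ <;> norm_cast <;>
    exact (natCast_inj_of_lt hk (by omega)).not.2 (by omega)

theorem isThreeCycle_tri (hn : 3 ≤ n) (i : Fin n) : (tri i).IsThreeCycle :=
  tri_eq i ▸ isThreeCycle_swap_mul_swap_same (add_one_ne_self (by omega) i)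
    (add_two_ne_add_one (by omega) i).symm (add_two_ne_self hn i).symm

theorem sign_tri (hn : 3 ≤ n) (i : Fin n) : sign (tri i) = 1 := (isThreeCycle_tri hn i).sign

theorem tri_pow_three (hn : 3 ≤ n) (i : Fin n) : tri i ^ 3 = 1 := by
  rw [← (isThreeCycle_tri hn i).orderOf, pow_orderOf_eq_one]

theorem commute_adj_add_two (hn : 4 ≤ n) (i : Fin n) : Commute (adj i) (adj (i + 1 + 1)) := by
  have h1 (j : Fin n) : j ≠ j + 1 := (add_one_ne_self (by omega) j).symm
  have h2 (j : Fin n) : j ≠ j + 1 + 1 := by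
    rw [add_assoc, one_add_one_eq_two]
    exact (add_two_ne_self (by omega) j).symm
  have h3 : i ≠ i + 1 + 1 + 1 := fun h =>
    natCast_ne_zero_of_lt (n := n) (k := 3) (by omega) (by omega)
      (by push_cast; linear_combination -h)
  refine (disjoint_swap_swap ?_).commute
  simp only [List.nodup_cons, List.mem_cons, List.not_mem_nil, or_false, not_or]
  exact ⟨⟨h1 _, h2 _, h3⟩, ⟨h1 _, h2 _⟩, h1 _, not_false, List.nodup_nil⟩

theorem tri_mul_tri_mul_self (hn : 4 ≤ n) (i : Fin n) :
    (tri i * tri (i + 1)) * (tri i * tri (i + 1)) = 1 := by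
  rw [tri_mul_tri, (commute_adj_add_two hn i).symm.mul_mul_mul_comm, adj_mul_self, adj_mul_self,
    one_mul]

theorem castLE_natCast_of_lt {k j : ℕ} [NeZero k] (h : k ≤ n) (hj : j < k) :
    (j : Fin k).castLE h = (j : Fin n) :=
  Fin.ext (by rw [Fin.val_castLE, Fin.val_cast_of_lt hj, Fin.val_cast_of_lt (hj.trans_le h)])

theorem firstLetters_adj {k j : ℕ} [NeZero k] (h : k ≤ n) (hj : j + 1 < k) :
    firstLetters h (adj (j : Fin k)) = adj (j : Fin n) := by
  rw [adj, firstLetters_swap, ← Nat.cast_add_one, castLE_natCast_of_lt h hj,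
    castLE_natCast_of_lt h (by omega), Nat.cast_add_one, adj]

theorem firstLetters_rot {k n : ℕ} (h : k + 1 ≤ n) :
    firstLetters h (rot (k + 1)) = (Fin.cycleRange ⟨k, h⟩)⁻¹ := by
  rw [rot, map_inv, ← Fin.cycleRange_last, firstLetters_cycleRange]
  rfl

end Letters

section Insertion

open scoped Fin.CommRing

/-- The permutations of the first `q + 2` letters among `q + 4`. -/
noncomputable abbrev base (q : ℕ) : Perm (Fin (q + 2)) →* Perm (Fin (q + 4)) :=
  firstLetters (by omega)

variable {q : ℕ}

theorem natCast_add_four : ((q : ℕ) : Fin (q + 4)) + 4 = 0 := mod_cast Fin.natCast_self (q + 4)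

theorem base_rot : base q (rot (q + 2)) = tri ((q + 1 : ℕ) : Fin (q + 4)) * rot (q + 4) := by
  have hq := natCast_add_four (q := q)
  have hq' : ((q : ℕ) : Fin (q + 2)) + 2 = 0 := mod_cast Fin.natCast_self (q + 2)
  refine firstLetters_eq _ (fun i => ?_) fun i hi => ?_
  · obtain ⟨k, hk, rfl⟩ : ∃ k, k < q + 2 ∧ i = (k : ℕ) := ⟨i, i.2, (Fin.cast_val_eq_self i).symm⟩
    rw [castLE_natCast_of_lt _ hk, mul_apply, rot_apply, rot_apply]
    obtain _ | k := k
    · rw [show ((0 : ℕ) : Fin (q + 2)) - 1 = (q + 1 : ℕ) by push_cast; linear_combination -hq',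
        castLE_natCast_of_lt _ (by omega),
        show ((0 : ℕ) : Fin (q + 4)) - 1 = (q + 1 : ℕ) + 2 by push_cast; linear_combination -hq,
        tri_apply_add_two]
    · rw [Nat.cast_add_one k, Nat.cast_add_one k, add_sub_cancel_right, add_sub_cancel_right,
        castLE_natCast_of_lt _ (by omega)]
      exact tri_natCast_apply_of_lt_or_lt (by omega) (by omega) (Or.inl (by omega))
  · obtain ⟨k, hk, rfl⟩ : ∃ k, k < q + 4 ∧ i = (k : ℕ) := ⟨i, i.2, (Fin.cast_val_eq_self i).symm⟩
    rw [Fin.val_cast_of_lt hk] at hi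
    rw [mul_apply, rot_apply]
    obtain rfl | rfl : k = q + 1 + 1 ∨ k = q + 1 + 2 := by omega
    · rw [Nat.cast_add_one (q + 1), add_sub_cancel_right, tri_apply_self (by omega)]
    · rw [show ((q + 1 + 2 : ℕ) : Fin (q + 4)) - 1 = (q + 1 : ℕ) + 1 by push_cast; ring,
        tri_apply_add_one (by omega), Nat.cast_add (q + 1), Nat.cast_two]

/-- Right multiplication by `spread q d` moves the letters in the last two places of a word which
begins with the other `q + 2`, and makes them the first letter and the one `q + 3 - d` places
behind it in cyclic order. -/
def spread (q : ℕ) : ℕ → Perm (Fin (q + 4))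
  | 0 => (tri ((q + 1 : ℕ) : Fin (q + 4)))⁻¹ * (tri ((q : ℕ) : Fin (q + 4)))⁻¹
  | d + 1 => spread q d * tri ((q - 2 * (d / 2) : ℕ) : Fin (q + 4))

theorem spread_one : spread q 1 = (tri ((q + 1 : ℕ) : Fin (q + 4)))⁻¹ :=
  inv_mul_cancel_right _ _

theorem spread_two :
    spread q 2 = (tri ((q + 1 : ℕ) : Fin (q + 4)))⁻¹ * tri ((q : ℕ) : Fin (q + 4)) := by
  rw [spread, spread_one]
  rfl

theorem spread_apply_last {d : ℕ} (hd : d ≤ q + 1) :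
    spread q d ((q + 3 : ℕ) : Fin (q + 4)) = (q + 2 : ℕ) := by
  induction d with
  | zero =>
    have h : tri ((q : ℕ) : Fin (q + 4)) ((q + 3 : ℕ) : Fin (q + 4)) = (q + 3 : ℕ) :=
      tri_natCast_apply_of_lt_or_lt (by omega) (by omega) (by omega)
    rw [spread, mul_apply, Perm.inv_eq_iff_eq.2 h.symm, Perm.inv_eq_iff_eq,
      Nat.cast_add_one (q + 1), tri_apply_add_one (by omega), ← Nat.cast_two, ← Nat.cast_add]
  | succ d ih =>
    rw [spread, mul_apply, tri_natCast_apply_of_lt_or_lt (by omega) (by omega) (by omega),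
      ih (by omega)]

theorem spread_apply_sub {d : ℕ} (hd : d ≤ q + 1) :
    spread q d ((q + 2 - d : ℕ) : Fin (q + 4)) = (q + 3 : ℕ) := by
  induction d with
  | zero =>
    have h : (tri ((q : ℕ) : Fin (q + 4)))⁻¹ ((q + 2 : ℕ) : Fin (q + 4)) = (q + 1 : ℕ) := by
      rw [Perm.inv_eq_iff_eq, Nat.cast_add_one q, tri_apply_add_one (by omega), Nat.cast_add,
        Nat.cast_two]
    rw [spread, mul_apply, Nat.sub_zero, h, Perm.inv_eq_iff_eq, Nat.cast_add (q + 1) 2,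
      Nat.cast_two, tri_apply_add_two]
  | succ d ih =>
    specialize ih (by omega)
    obtain ⟨j, hj⟩ : ∃ j, q - 2 * (d / 2) = j := ⟨_, rfl⟩
    rw [spread, mul_apply, hj]
    obtain ⟨h, h'⟩ | ⟨h, h'⟩ : q + 2 - (d + 1) = j + 1 ∧ q + 2 - d = j + 2 ∨
        q + 2 - (d + 1) = j ∧ q + 2 - d = j + 1 := by omega
    · rw [h, Nat.cast_add_one, tri_apply_add_one (by omega), ← ih, h', Nat.cast_add, Nat.cast_two]
    · rw [h, tri_apply_self (by omega), ← ih, h', Nat.cast_add_one]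

/-- `base q y * ins q i` is the word `y` with the last two letters inserted so that, in cyclic
order, the letter `q + 3` comes `i + 1` places behind the letter `q + 2`. -/
def ins (q i : ℕ) : Perm (Fin (q + 4)) := if i = 0 then 1 else spread q (q + 2 - i)

theorem ins_zero : ins q 0 = 1 := rfl

theorem ins_add_one_eq (hq : Odd q) {i : ℕ} (hi : Odd i) (hiq : i ≤ q) :
    ins q (i + 1) = ins q (i + 2) * tri (i : Fin (q + 4)) := by
  obtain ⟨s, rfl⟩ := hq
  obtain ⟨t, rfl⟩ := hi
  obtain ⟨d, rfl⟩ := Nat.exists_eq_add_of_le (show t ≤ s by omega)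
  rw [ins, ins, if_neg (by omega), if_neg (by omega)]
  rw [show 2 * (t + d) + 1 + 2 - (2 * t + 1 + 1) = 2 * d + 1 by omega,
    show 2 * (t + d) + 1 + 2 - (2 * t + 1 + 2) = 2 * d by omega, spread,
    show 2 * (t + d) + 1 - 2 * (2 * d / 2) = 2 * t + 1 by omega]

theorem ins_eq (hq : Odd q) {i : ℕ} (hi : Odd i) (hiq : i ≤ q) :
    ins q i = ins q (i + 1) * tri (i : Fin (q + 4)) := by
  obtain ⟨s, rfl⟩ := hq
  obtain ⟨t, rfl⟩ := hi
  obtain ⟨d, rfl⟩ := Nat.exists_eq_add_of_le (show t ≤ s by omega)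
  rw [ins, ins, if_neg (by omega), if_neg (by omega)]
  rw [show 2 * (t + d) + 1 + 2 - (2 * t + 1 + 1) = 2 * d + 1 by omega,
    show 2 * (t + d) + 1 + 2 - (2 * t + 1) = 2 * d + 1 + 1 by omega, spread,
    show 2 * (t + d) + 1 - 2 * ((2 * d + 1) / 2) = 2 * t + 1 by omega]

theorem exists_ins_apply {i : ℕ} (hi : i ≤ q + 2) : ∃ p : Fin (q + 4),
    ins q i p = (q + 2 : ℕ) ∧ ins q i (p + (i + 1 : ℕ)) = (q + 3 : ℕ) := by
  obtain rfl | hi0 := eq_or_ne i 0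
  · exact ⟨(q + 2 : ℕ), rfl, by rw [← Nat.cast_add]; rfl⟩
  have hq := natCast_add_four (q := q)
  have hi' : ((q + 3 : ℕ) : Fin (q + 4)) + (i + 1 : ℕ) = (q + 2 - (q + 2 - i) : ℕ) := by
    rw [Nat.sub_sub_self hi]
    push_cast
    linear_combination hq
  refine ⟨(q + 3 : ℕ), ?_, ?_⟩ <;> rw [ins, if_neg hi0]
  · exact spread_apply_last (by omega)
  · rw [hi', spread_apply_sub (by omega)]

/-- The number of places, in cyclic order, by which the letter `q + 3` comes behind the letter
`q + 2`. -/
def gap (x : Perm (Fin (q + 4))) : Fin (q + 4) :=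
  x⁻¹ ((q + 3 : ℕ) : Fin (q + 4)) - x⁻¹ ((q + 2 : ℕ) : Fin (q + 4))

theorem gap_eq {x : Perm (Fin (q + 4))} {i p : Fin (q + 4)} (hp : x p = (q + 2 : ℕ))
    (hpi : x (p + i) = (q + 3 : ℕ)) : gap x = i := by
  rw [gap, Perm.inv_eq_iff_eq.2 hpi.symm, Perm.inv_eq_iff_eq.2 hp.symm, add_sub_cancel_left]

theorem gap_mul_of_mem_zpowers {z : Perm (Fin (q + 4))} (x : Perm (Fin (q + 4)))
    (hz : z ∈ zpowers (rot (q + 4))) : gap (x * z) = gap x := by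
  obtain ⟨k, rfl⟩ := mem_powers_iff_mem_zpowers.2 hz
  refine gap_eq (p := x⁻¹ ((q + 2 : ℕ) : Fin (q + 4)) + (k : Fin (q + 4))) ?_ ?_ <;>
    dsimp only <;> rw [mul_apply, rot_pow_apply]
  · rw [add_sub_cancel_right]
    exact x.apply_symm_apply _
  · rw [gap, add_right_comm, add_sub_cancel_right, add_sub_cancel]
    exact x.apply_symm_apply _

theorem base_apply_natCast (y : Perm (Fin (q + 2))) {j : ℕ} (hj : q + 2 ≤ j) (hj' : j < q + 4) :
    base q y (j : Fin (q + 4)) = (j : Fin (q + 4)) :=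
  firstLetters_of_le _ _ (by rwa [Fin.val_cast_of_lt hj'])

theorem gap_base_mul_ins (y : Perm (Fin (q + 2))) {i : ℕ} (hi : i ≤ q + 2) :
    gap (base q y * ins q i) = (i + 1 : ℕ) := by
  obtain ⟨p, hp, hpi⟩ := exists_ins_apply hi
  refine gap_eq (p := p) ?_ ?_
  · rw [mul_apply, hp, base_apply_natCast _ (by omega) (by omega)]
  · rw [mul_apply, hpi, base_apply_natCast _ (by omega) (by omega)]

/-- The coset of `⟨rot⟩` which the label `(y, i)` stands for. -/
noncomputable def labelCoset (p : Perm (Fin (q + 2)) × ℕ) :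
    Perm (Fin (q + 4)) ⧸ zpowers (rot (q + 4)) :=
  (base q p.1 * ins q p.2 : Perm (Fin (q + 4)))

theorem labelCoset_injOn :
    Set.InjOn (labelCoset (q := q)) (Set.univ ×ˢ Set.Iic (q + 2)) := by
  rintro ⟨y, i⟩ ⟨-, hi⟩ ⟨y', i'⟩ ⟨-, hi'⟩ h
  replace hi : i ≤ q + 2 := hi
  replace hi' : i' ≤ q + 2 := hi'
  replace h : (base q y * ins q i)⁻¹ * (base q y' * ins q i') ∈ zpowers (rot (q + 4)) :=
    QuotientGroup.eq.1 h
  have hgap := gap_mul_of_mem_zpowers (base q y * ins q i) h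
  rw [mul_inv_cancel_left, gap_base_mul_ins _ hi, gap_base_mul_ins _ hi',
    natCast_inj_of_lt (by omega) (by omega)] at hgap
  obtain rfl : i = i' := by omega
  obtain ⟨p, hp, -⟩ := exists_ins_apply hi
  have h1 := eq_one_of_mem_zpowers_rot h (i := p) (by
    rw [mul_apply, Perm.inv_eq_iff_eq, mul_apply, mul_apply, hp,
      base_apply_natCast _ (by omega) (by omega), base_apply_natCast _ (by omega) (by omega)])
  rw [inv_mul_eq_one, mul_left_inj] at h1
  rw [firstLetters_injective _ h1]

theorem sign_spread (d : ℕ) : sign (spread q d) = 1 := by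
  induction d with
  | zero => simp [spread, sign_tri]
  | succ d ih => simp [spread, sign_tri, ih]

theorem sign_ins (i : ℕ) : sign (ins q i) = 1 := by
  rw [ins]
  split_ifs
  · exact map_one _
  · exact sign_spread _

theorem exists_labelCoset_eq (hq : Odd q) {x : Perm (Fin (q + 4))} (hx : sign x = 1) :
    ∃ y : Perm (Fin (q + 2)), sign y = 1 ∧ ∃ i ≤ q + 2, labelCoset (y, i) = x := by
  obtain ⟨i, hi, hgap⟩ : ∃ i ≤ q + 2, gap x = (i + 1 : ℕ) := by
    have h0 : gap x ≠ 0 := by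
      rw [gap, sub_ne_zero, x⁻¹.injective.ne_iff, Ne, natCast_inj_of_lt] <;> omega
    have h0' := Fin.val_ne_zero_iff.2 h0
    refine ⟨gap x - 1, by omega, ?_⟩
    rw [Nat.sub_add_cancel (by omega), Fin.cast_val_eq_self]
  obtain ⟨p, hp, hpi⟩ := exists_ins_apply hi
  obtain ⟨k, hk⟩ : ∃ k : ℕ, (k : Fin (q + 4)) = p - x⁻¹ ((q + 2 : ℕ) : Fin (q + 4)) :=
    ⟨_, Fin.cast_val_eq_self _⟩
  have hrot (j : Fin (q + 4)) :
      (rot (q + 4) ^ k) (p + j) = x⁻¹ ((q + 2 : ℕ) : Fin (q + 4)) + j := by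
    rw [rot_pow_apply, hk]
    ring
  obtain ⟨y, hy⟩ : ∃ y, base q y = x * rot (q + 4) ^ k * (ins q i)⁻¹ := by
    refine exists_firstLetters_eq _ fun j hj => ?_
    obtain rfl | rfl : j = (q + 2 : ℕ) ∨ j = (q + 3 : ℕ) := by
      rw [Fin.ext_iff, Fin.ext_iff, Fin.val_cast_of_lt, Fin.val_cast_of_lt] <;> omega
    · rw [mul_apply, Perm.inv_eq_iff_eq.2 hp.symm, mul_apply, ← add_zero p, hrot, add_zero]
      exact x.apply_symm_apply _
    · rw [mul_apply, Perm.inv_eq_iff_eq.2 hpi.symm, mul_apply, hrot, ← hgap, gap, add_sub_cancel]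
      exact x.apply_symm_apply _
  refine ⟨y, ?_, i, hi, ?_⟩
  · rw [← sign_firstLetters (by omega : q + 2 ≤ q + 4), hy]
    simp [hx, sign_ins, sign_rot (hq.add_even (by decide : Even 4))]
  · rw [labelCoset, hy, inv_mul_cancel_right]
    exact QuotientGroup.mk_mul_of_mem _ (pow_mem (mem_zpowers _) _)

end Insertion

section Triples

open scoped Fin.CommRing

variable {q : ℕ}

theorem ins_add_two : ins q (q + 2) =
    (tri ((q + 1 : ℕ) : Fin (q + 4)))⁻¹ * (tri ((q : ℕ) : Fin (q + 4)))⁻¹ := by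
  rw [ins, if_neg (by omega), Nat.sub_self, spread]

theorem ins_add_one : ins q (q + 1) = (tri ((q + 1 : ℕ) : Fin (q + 4)))⁻¹ := by
  rw [ins, if_neg (by omega), Nat.add_sub_add_left, spread_one]

theorem ins_self (hq : q ≠ 0) : ins q q =
    (tri ((q + 1 : ℕ) : Fin (q + 4)))⁻¹ * tri ((q : ℕ) : Fin (q + 4)) := by
  rw [ins, if_neg hq, Nat.add_sub_cancel_left, spread_two]

theorem inv_mul_mul_mul_eq {G : Type*} [Group G] {a u w : G} (hw : w ^ 3 = 1)
    (huw : (u * w) * (u * w) = 1) (ha : u * a = a * w) :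
    w⁻¹ * u * w * a = w * a * w⁻¹ := by
  have huw' : u * w = w⁻¹ * u⁻¹ := by rw [← mul_inv_rev]; exact eq_inv_of_mul_eq_one_left huw
  have hu : u⁻¹ * a = a * w⁻¹ := by
    rw [inv_mul_eq_iff_eq_mul, ← mul_assoc, ha, mul_inv_cancel_right]
  calc w⁻¹ * u * w * a = w⁻¹ * w⁻¹ * (u⁻¹ * a) := by rw [mul_assoc w⁻¹ u w, huw']; group
    _ = w * a * w⁻¹ := by rw [hu, ← mul_inv_rev, mul_self_eq_inv_of_pow_three hw]; group

theorem inv_mul_mul_inv_mul_eq {G : Type*} [Group G] {a d u w : G} (hw : w ^ 3 = 1) (hu : u ^ 3 = 1)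
    (huw : (u * w) * (u * w) = 1) (ha : u * a = a * w)
    (hd : u * w * a ^ 2 * (u * w) = a ^ 2 * d) :
    w⁻¹ * u * w⁻¹ * a ^ 2 = (w * a) ^ 2 * d * w⁻¹ * u⁻¹ := by
  have hwuw : w⁻¹ * u * w⁻¹ = w * u⁻¹ * w := by
    have h : u⁻¹ = w * u * w := by
      rw [inv_eq_iff_mul_eq_one]
      simpa only [mul_assoc] using huw
    have hw' : w * w = w⁻¹ := mul_self_eq_inv_of_pow_three hw
    rw [h, ← mul_assoc, ← mul_assoc, hw', mul_assoc _ w w, hw']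
  calc w⁻¹ * u * w⁻¹ * a ^ 2 = w * (u * u) * w * a ^ 2 := by
        rw [hwuw, mul_self_eq_inv_of_pow_three hu]
    _ = w * (u * a) * a⁻¹ * (u * w * a ^ 2 * (u * w)) * w⁻¹ * u⁻¹ := by group
    _ = (w * a) ^ 2 * d * w⁻¹ * u⁻¹ := by rw [hd, ha, pow_two (w * a)]; group

theorem tri_mul_rot (i : Fin (q + 4)) : tri i * rot (q + 4) = rot (q + 4) * tri (i + 1) := by
  simpa using tri_mul_rot_pow i 1

theorem tri_mul_tri_mul_rot_sq :
    tri (q : Fin (q + 4)) * tri ((q + 1 : ℕ) : Fin (q + 4)) * rot (q + 4) ^ 2 *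
      (tri (q : Fin (q + 4)) * tri ((q + 1 : ℕ) : Fin (q + 4))) =
      rot (q + 4) ^ 2 * base q (adj 0 * adj (q : Fin (q + 2))) := by
  have hq : (q : Fin (q + 4)) + 1 + 1 + 1 + 1 = 0 := by linear_combination natCast_add_four (q := q)
  have h0 : adj (q + 1 + 1 : Fin (q + 4)) * adj 0 = adj 0 * adj (q + 1 + 1 : Fin (q + 4)) := by
    rw [← hq]
    exact commute_adj_add_two (by omega) _
  have hbase : base q (adj 0 * adj (q : Fin (q + 2))) = adj 0 * adj (q : Fin (q + 4)) := by
    rw [map_mul, ← Nat.cast_zero, firstLetters_adj _ (by omega), firstLetters_adj _ (by omega),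
      Nat.cast_zero]
  have hrot (i : Fin (q + 4)) : adj i * rot (q + 4) ^ 2 = rot (q + 4) ^ 2 * adj (i + 1 + 1) := by
    rw [adj_mul_rot_pow, Nat.cast_two, add_assoc, one_add_one_eq_two]
  rw [Nat.cast_add_one, tri_mul_tri, hbase]
  calc adj (q : Fin (q + 4)) * adj (q + 1 + 1 : Fin (q + 4)) * rot (q + 4) ^ 2 *
        (adj (q : Fin (q + 4)) * adj (q + 1 + 1 : Fin (q + 4)))
      = rot (q + 4) ^ 2 * (adj (q + 1 + 1 : Fin (q + 4)) * adj 0) *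
        (adj (q : Fin (q + 4)) * adj (q + 1 + 1 : Fin (q + 4))) := by
        rw [mul_assoc (adj _) (adj _) (_ ^ _), hrot, hq, ← mul_assoc (adj _) (_ ^ _), hrot,
          mul_assoc (_ ^ _)]
    _ = rot (q + 4) ^ 2 * (adj 0 * adj (q : Fin (q + 4))) := by
        rw [h0, (commute_adj_add_two (by omega) _).eq, mul_assoc, mul_assoc (adj 0),
          ← mul_assoc (adj (_ + 1)), adj_mul_self, one_mul]

theorem labelCoset_eq {x z : Perm (Fin (q + 4))} {y : Perm (Fin (q + 2))} {i : ℕ}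
    (hz : z ∈ zpowers (rot (q + 4))) (h : x * z = base q y * ins q i) : labelCoset (y, i) = x := by
  rw [labelCoset, ← h, QuotientGroup.mk_mul_of_mem _ hz]

theorem isTriple_labelCoset_chain (hq : Odd q) (y : Perm (Fin (q + 2))) {i : ℕ} (hi : Odd i)
    (hiq : i ≤ q) : IsTriple (rot (q + 4)) (tri ((q + 1 : ℕ) : Fin (q + 4)))
      (labelCoset (y, i + 2)) (labelCoset (y, i + 1)) (labelCoset (y, i)) := by
  set w := tri ((q + 1 : ℕ) : Fin (q + 4))
  obtain ⟨e, he⟩ := Nat.exists_eq_add_of_le (show i ≤ q + 1 by omega)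
  have hw : tri (i : Fin (q + 4)) * rot (q + 4) ^ e = rot (q + 4) ^ e * w := by
    rw [tri_mul_rot_pow, ← Nat.cast_add, ← he]
  have hz : (rot (q + 4) ^ e)⁻¹ ∈ zpowers (rot (q + 4)) := inv_mem (pow_mem (mem_zpowers _) _)
  refine ⟨base q y * ins q (i + 2) * rot (q + 4) ^ e, labelCoset_eq hz (mul_inv_cancel_right _ _),
    labelCoset_eq hz ?_, labelCoset_eq hz ?_⟩
  · rw [mul_assoc _ _ w, ← hw, ← mul_assoc, mul_inv_cancel_right, mul_assoc,
      ins_add_one_eq hq hi hiq]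
  · have hi3 := mul_self_eq_inv_of_pow_three (tri_pow_three (by omega) (i : Fin (q + 4)))
    rw [ins_eq hq hi hiq, ins_add_one_eq hq hi hiq, mul_assoc (ins _ _), hi3]
    rw [eq_mul_inv_iff_mul_eq.2 hw]
    group

theorem isTriple_labelCoset_ring (y : Perm (Fin (q + 2))) :
    IsTriple (rot (q + 4)) (tri ((q + 1 : ℕ) : Fin (q + 4)))
      (labelCoset (y, 0)) (labelCoset (y * rot (q + 2), 0)) (labelCoset (y, q + 1)) := by
  refine ⟨base q y, ?_, ?_, ?_⟩
  · rw [labelCoset, ins_zero, mul_one]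
  · exact labelCoset_eq (mem_zpowers _) (by rw [map_mul, base_rot, ins_zero, mul_one, mul_assoc])
  · rw [labelCoset, ins_add_one]

theorem isTriple_labelCoset_link (hq : q ≠ 0) (y : Perm (Fin (q + 2))) :
    IsTriple (rot (q + 4)) (tri ((q + 1 : ℕ) : Fin (q + 4)))
      (labelCoset (y * (adj 0 * adj (q : Fin (q + 2)))⁻¹ * (rot (q + 2))⁻¹ * (rot (q + 2))⁻¹, q))
      (labelCoset (y * (adj 0 * adj (q : Fin (q + 2)))⁻¹ * (rot (q + 2))⁻¹, q + 1))
      (labelCoset (y, q + 2)) := by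
  set d := adj 0 * adj (q : Fin (q + 2))
  obtain ⟨v, rfl⟩ : ∃ v, v * rot (q + 2) ^ 2 * d = y := ⟨y * d⁻¹ * (rot (q + 2) ^ 2)⁻¹, by
    rw [inv_mul_cancel_right, inv_mul_cancel_right]⟩
  have ha := tri_mul_rot (q : Fin (q + 4))
  have huw := tri_mul_tri_mul_self (by omega) (q : Fin (q + 4))
  have hd := tri_mul_tri_mul_rot_sq (q := q)
  have hu := tri_pow_three (by omega) (q : Fin (q + 4))
  have hw := tri_pow_three (by omega) ((q + 1 : ℕ) : Fin (q + 4))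
  rw [← Nat.cast_add_one] at ha huw
  have hv : v * rot (q + 2) ^ 2 * d * d⁻¹ * (rot (q + 2))⁻¹ = v * rot (q + 2) := by
    rw [mul_inv_cancel_right, pow_two, ← mul_assoc, mul_inv_cancel_right]
  refine ⟨base q v * ins q q, ?_, labelCoset_eq (mem_zpowers _) ?_,
    labelCoset_eq (pow_mem (mem_zpowers _) 2) ?_⟩
  · rw [hv, mul_inv_cancel_right, labelCoset]
  · rw [hv, ins_self hq, ins_add_one, mul_assoc (base q v), mul_assoc (base q v),
      inv_mul_mul_mul_eq hw huw ha, ← base_rot, ← mul_assoc, ← map_mul]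
  · rw [ins_self hq, ins_add_two, mul_assoc (base q v), mul_assoc (base q v),
      inv_mul_mul_inv_mul_eq hw hu huw ha hd, ← base_rot]
    simp only [d, map_mul, map_pow, mul_assoc]

theorem LabelTriple.isTriple (hq : Odd q) {p p' p'' : Perm (Fin (q + 2)) × ℕ}
    (h : LabelTriple (rot (q + 2)) (adj 0 * adj (q : Fin (q + 2)))⁻¹ q p p' p'') :
    IsTriple (rot (q + 4)) (tri ((q + 1 : ℕ) : Fin (q + 4)))
      (labelCoset p) (labelCoset p') (labelCoset p'') := by
  induction h with
  | chain y hi hiq => exact isTriple_labelCoset_chain hq y hi hiq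
  | ring y => exact isTriple_labelCoset_ring y
  | link y => exact isTriple_labelCoset_link hq.pos.ne' y
  | rotate _ ih => exact ih.rotate (tri_pow_three (by omega) _)

end Triples

section Generation

open scoped Fin.CommRing

theorem sign_adj {n : ℕ} [NeZero n] (hn : 2 ≤ n) (i : Fin n) : sign (adj i) = -1 :=
  sign_swap (add_one_ne_self hn i).symm

theorem alternatingGroup_le_of_adj_mul_adj_mem {n : ℕ} {H : Subgroup (Perm (Fin (n + 1)))}
    (hH : ∀ i j : Fin (n + 1), adj i * adj j ∈ H) : alternatingGroup (Fin (n + 1)) ≤ H := by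
  have key (g : Perm (Fin (n + 1))) : g ∈ H ∧ sign g = 1 ∨ adj 0 * g ∈ H ∧ sign g = -1 := by
    have hg : g ∈ Submonoid.closure (Set.range fun i : Fin n => swap i.castSucc i.succ) := by
      rw [mclosure_swap_castSucc_succ]
      trivial
    induction hg using Submonoid.closure_induction_left with
    | one => exact .inl ⟨H.one_mem, map_one _⟩
    | mul_left x hx g _ ih =>
      obtain ⟨i, rfl⟩ := hx
      have hadj : swap i.castSucc i.succ = adj i.castSucc := by rw [adj, Fin.coeSucc_eq_succ]
      have hsign : sign (swap i.castSucc i.succ * g) = -sign g := by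
        rw [Perm.sign_mul, sign_swap (Fin.castSucc_lt_succ).ne, neg_one_mul]
      dsimp only
      rw [hsign, hadj]
      obtain ⟨hg, h⟩ | ⟨hg, h⟩ := ih
      · exact .inr ⟨by simpa only [mul_assoc] using H.mul_mem (hH 0 i.castSucc) hg, by rw [h]⟩
      · refine .inl ⟨?_, by rw [h, neg_neg]⟩
        have := H.mul_mem (hH i.castSucc 0) hg
        rwa [mul_assoc, ← mul_assoc (adj 0), adj_mul_self, one_mul] at this
  intro g hg
  obtain ⟨h, -⟩ | ⟨-, h⟩ := key g
  · exact h
  · rw [mem_alternatingGroup.1 hg] at h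
    exact absurd h (by decide)

theorem alternatingGroup_le_of_rot_mem {n : ℕ} (hn : Even n) {H : Subgroup (Perm (Fin (n + 1)))}
    (hrot : rot (n + 1) ∈ H) (hadj : adj 0 * adj (-2 : Fin (n + 1)) ∈ H) :
    alternatingGroup (Fin (n + 1)) ≤ H := by
  have hstep (i : Fin (n + 1)) : adj (i + 2) * adj i ∈ H := by
    obtain ⟨k, rfl⟩ : ∃ k : ℕ, -2 + (k : Fin (n + 1)) = i :=
      ⟨(i + 2 : Fin (n + 1)).val, by rw [Fin.cast_val_eq_self, add_comm i, neg_add_cancel_left]⟩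
    rw [add_right_comm, neg_add_cancel, zero_add]
    have := H.mul_mem (H.inv_mem (H.pow_mem hrot k)) (H.mul_mem hadj (H.pow_mem hrot k))
    rwa [mul_assoc, adj_mul_rot_pow, ← mul_assoc (adj 0), adj_mul_rot_pow, mul_assoc,
      inv_mul_cancel_left, zero_add] at this
  have heven (i : Fin (n + 1)) (k : ℕ) : adj (i + 2 * (k : Fin (n + 1))) * adj i ∈ H := by
    induction k with
    | zero => simp [adj_mul_self, H.one_mem]
    | succ k ih =>
      have := H.mul_mem (hstep (i + 2 * (k : Fin (n + 1)))) ih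
      rw [mul_assoc, ← mul_assoc (adj (i + _)), adj_mul_self, one_mul] at this
      rwa [Nat.cast_add_one, mul_add_one, ← add_assoc]
  refine alternatingGroup_le_of_adj_mul_adj_mem fun i j => ?_
  obtain ⟨m, rfl⟩ := hn
  have hm : (m : Fin (m + m + 1)) + m + 1 = 0 := mod_cast Fin.natCast_self (m + m + 1)
  obtain ⟨k, hk⟩ : ∃ k : ℕ, (k : Fin (m + m + 1)) = (i - j) * (m + 1) :=
    ⟨_, Fin.cast_val_eq_self _⟩
  have hi : j + 2 * (k : Fin (m + m + 1)) = i := by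
    rw [hk]
    linear_combination (i - j) * hm
  exact hi ▸ heven j k

theorem closure_rot_eq_alternatingGroup {q : ℕ} (hq : Odd q) :
    Subgroup.closure {rot (q + 2), (adj 0 * adj (q : Fin (q + 2)))⁻¹} =
      alternatingGroup (Fin (q + 2)) := by
  have hq2 : (q : Fin (q + 2)) = -2 :=
    eq_neg_of_add_eq_zero_left (mod_cast Fin.natCast_self (q + 2))
  refine le_antisymm ?_ (alternatingGroup_le_of_rot_mem (n := q + 1) hq.add_one ?_ ?_)
  · rw [Subgroup.closure_le]
    rintro _ (rfl | rfl)
    · exact sign_rot (hq.add_even even_two)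
    · rw [SetLike.mem_coe, inv_mem_iff, mem_alternatingGroup, Perm.sign_mul, sign_adj (by omega),
        sign_adj (by omega)]
      decide
  · exact Subgroup.subset_closure (by simp)
  · rw [← hq2]
    exact inv_mem_iff.1 (Subgroup.subset_closure (by simp))

end Generation

section Joining

open scoped Fin.CommRing

variable {q : ℕ}

theorem orderOf_rot (n : ℕ) : orderOf (rot (n + 2)) = n + 2 := by
  rw [rot, orderOf_inv, isCycle_finRotate.orderOf, support_finRotate, Finset.card_univ,
    Fintype.card_fin]

theorem coe_zpowers_tri_mul_rot :
    (zpowers (tri ((q + 1 : ℕ) : Fin (q + 4)) * rot (q + 4)) : Set (Perm (Fin (q + 4)))) =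
      base q '' zpowers (rot (q + 2)) := by
  rw [← base_rot, ← MonoidHom.map_zpowers, Subgroup.coe_map]

theorem labelCoset_zero (y : Perm (Fin (q + 2))) : labelCoset (y, 0) = base q y := by
  rw [labelCoset, ins_zero, mul_one]

theorem labelCoset_add_one (y : Perm (Fin (q + 2))) :
    labelCoset (y, q + 1) = (base q y * (tri ((q + 1 : ℕ) : Fin (q + 4)))⁻¹ : Perm _) := by
  rw [labelCoset, ins_add_one]

theorem eq_and_eq_of_labelCoset_eq {y z : Perm (Fin (q + 2))} {i j : ℕ} (hi : i ≤ q + 2)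
    (hj : j ≤ q + 2) (h : labelCoset (y, i) = labelCoset (z, j)) : y = z ∧ i = j :=
  Prod.mk_inj.1 (labelCoset_injOn (Set.mk_mem_prod trivial hi) (Set.mk_mem_prod trivial hj) h)

theorem isRing_rot_tri : IsRing (rot (q + 4)) (tri ((q + 1 : ℕ) : Fin (q + 4))) := by
  refine ⟨?_, ?_, ?_⟩
  · rw [coe_zpowers_tri_mul_rot]
    rintro _ ⟨y, -, rfl⟩ _ ⟨z, -, rfl⟩ h
    simp only [← labelCoset_zero] at h
    rw [(eq_and_eq_of_labelCoset_eq (by omega) (by omega) h).1]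
  · rw [coe_zpowers_tri_mul_rot]
    rintro _ ⟨y, -, rfl⟩ _ ⟨z, -, rfl⟩ h
    simp only [← labelCoset_add_one] at h
    rw [(eq_and_eq_of_labelCoset_eq (by omega) (by omega) h).1]
  · simp only [← SetLike.mem_coe, coe_zpowers_tri_mul_rot]
    rintro _ ⟨y, -, rfl⟩ _ ⟨z, -, rfl⟩ h
    rw [← labelCoset_zero, ← labelCoset_add_one] at h
    have := (eq_and_eq_of_labelCoset_eq (by omega) (by omega) h).2
    omega

theorem ringCosets_rot_tri : ringCosets (rot (q + 4)) (tri ((q + 1 : ℕ) : Fin (q + 4))) =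
    labelCoset '' ((zpowers (rot (q + 2)) : Set (Perm (Fin (q + 2)))) ×ˢ {0, q + 1}) := by
  ext p
  simp only [ringCosets, ← SetLike.mem_coe, coe_zpowers_tri_mul_rot]
  constructor
  · rintro ⟨_, ⟨y, hy, rfl⟩, rfl | rfl⟩
    · exact ⟨(y, 0), ⟨hy, .inl rfl⟩, labelCoset_zero y⟩
    · exact ⟨(y, q + 1), ⟨hy, .inr rfl⟩, labelCoset_add_one y⟩
  · rintro ⟨⟨y, i⟩, ⟨hy, rfl | rfl⟩, rfl⟩
    · exact ⟨_, ⟨y, hy, rfl⟩, .inl (labelCoset_zero y)⟩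
    · exact ⟨_, ⟨y, hy, rfl⟩, .inr (labelCoset_add_one y)⟩

theorem labelCoset_image_alternatingGroup (hq : Odd q) :
    labelCoset '' ((alternatingGroup (Fin (q + 2)) : Set (Perm (Fin (q + 2)))) ×ˢ Set.Iic (q + 2)) =
      QuotientGroup.mk '' (alternatingGroup (Fin (q + 4)) : Set (Perm (Fin (q + 4)))) := by
  ext p
  constructor
  · rintro ⟨⟨y, i⟩, ⟨hy, -⟩, rfl⟩
    refine ⟨_, mem_alternatingGroup.2 ?_, rfl⟩
    rw [Perm.sign_mul, sign_firstLetters, mem_alternatingGroup.1 hy, sign_ins, mul_one]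
  · rintro ⟨x, hx, rfl⟩
    obtain ⟨y, hy, i, hi, h⟩ := exists_labelCoset_eq hq (mem_alternatingGroup.1 hx)
    exact ⟨(y, i), ⟨mem_alternatingGroup.2 hy, hi⟩, h⟩

theorem exists_isJoined_alternatingGroup (hq : Odd q) :
    ∃ S, IsJoined (rot (q + 4)) (tri ((q + 1 : ℕ) : Fin (q + 4)))
      (zpowers (tri ((q + 1 : ℕ) : Fin (q + 4)) * rot (q + 4)) : Set _)
      (QuotientGroup.mk '' (alternatingGroup (Fin (q + 4)) : Set (Perm (Fin (q + 4))))) S := by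
  have hr : tri ((q + 1 : ℕ) : Fin (q + 4)) ^ 3 = 1 := tri_pow_three (by omega) _
  have hlabels := grows_closure (d := (adj 0 * adj (q : Fin (q + 2)))⁻¹) hq (orderOf_rot q)
  rw [closure_rot_eq_alternatingGroup hq] at hlabels
  have hcosets := hlabels.image (labelCoset_injOn.mono (Set.prod_mono_left (Set.subset_univ _)))
    fun _ _ _ _ _ _ => LabelTriple.isTriple hq
  rw [← ringCosets_rot_tri, labelCoset_image_alternatingGroup hq] at hcosets
  exact (isRing_rot_tri.isJoined hr).exists_of_grows hr hcosets

end Joining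

section CycleList

section ToList

variable {α : Type*} [Fintype α] [DecidableEq α] {F : Perm α} {x : α}

theorem isChain_toList (F : Perm α) (x : α) : (F.toList x).IsChain fun y z => z = F y := by
  rw [List.isChain_iff_getElem]
  intro i hi
  rw [getElem_toList, getElem_toList, pow_succ', mul_apply]

theorem head?_toList (hx : F x ≠ x) : (F.toList x).head? = some x := by
  have hpos := length_toList_pos_of_mem_support F x (mem_support.2 hx)
  rw [List.head?_eq_getElem?, List.getElem?_eq_getElem hpos, getElem_toList, pow_zero, one_apply]

theorem getLast?_toList (hx : F x ≠ x) : (F.toList x).getLast? = some (F⁻¹ x) := by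
  have hpos := length_toList_pos_of_mem_support F x (mem_support.2 hx)
  rw [List.getLast?_eq_getElem?, List.getElem?_eq_getElem (by omega), getElem_toList,
    Option.some_inj, eq_inv_iff_eq, ← mul_apply, ← pow_succ', Nat.sub_add_cancel hpos,
    length_toList, ← pow_mod_card_support_cycleOf_self_apply, Nat.mod_self, pow_zero, one_apply]

end ToList

theorem mem_of_sameCycle {α : Type*} [Finite α] {F : Perm α} {s : Set α} {x y : α}
    (hs : ∀ w ∈ s, F w ∈ s) (h : F.SameCycle x y) (hx : x ∈ s) : y ∈ s := by
  obtain ⟨k, rfl⟩ := h.exists_nat_pow_eq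
  rw [← iterate_eq_pow]
  exact Set.MapsTo.iterate hs k hx

variable {G : Type*} [Group G] [Finite G] {a r : G} {N : Set (G ⧸ zpowers a)}
  {S : Set (G ⧸ zpowers r)}

theorem IsJoined.sameCycle_iff (h : IsJoined a r (zpowers (r * a)) N S) {v w : G}
    (hv : v ∉ zpowers (r * a)) (hvN : (v : G ⧸ zpowers a) ∈ N) :
    (switched a r S).SameCycle v w ↔ (w : G ⧸ zpowers a) ∈ N ∧ w ∉ zpowers (r * a) := by
  have hM : ∀ x ∈ zpowers (r * a), switched a r S x ∈ zpowers (r * a) := fun x hx => by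
    rw [switched_of_mem (h.switched_mem x hx), mul_assoc]
    exact mul_mem hx (mem_zpowers _)
  refine ⟨fun hvw => ⟨?_, fun hw => hv ?_⟩, fun ⟨hwN, hw⟩ => h.sameCycle v w hv hw hvN hwN⟩
  · exact mem_of_sameCycle (s := {x : G | (x : G ⧸ zpowers a) ∈ N})
      (fun _ => h.mk_switched_mem) hvw hvN
  · exact mem_of_sameCycle (s := zpowers (r * a)) hM hvw.symm hw

theorem IsJoined.exists_list (h : IsJoined a r (zpowers (r * a)) N S)
    (ha : a ∉ zpowers (r * a)) (hra : r * a ≠ 1) :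
    ∃ C : List G, C.Nodup ∧ C.IsChain (fun x y => y = x * a ∨ y = x * (r * a)) ∧
      C.head? = some a ∧ C.getLast? = some r⁻¹ ∧
      ∀ x, x ∈ C ↔ (x : G ⧸ zpowers a) ∈ N ∧ x ∉ zpowers (r * a) := by
  classical
  have := Fintype.ofFinite G
  have h1S : ((1 : G) : G ⧸ zpowers r) ∈ S := h.switched_mem 1 (one_mem _)
  have haN : (a : G ⧸ zpowers a) ∈ N := by
    have ha1 : (a : G ⧸ zpowers a) = (1 : G) := by simpa only [one_mul] using mk_mul_self a 1
    exact ha1 ▸ h.mk_mem 1 h1S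
  have hstep (x : G) : switched a r S x = x * a ∨ switched a r S x = x * (r * a) := by
    by_cases hx : (x : G ⧸ zpowers r) ∈ S
    · exact .inr (by rw [switched_of_mem hx, mul_assoc])
    · exact .inl (switched_of_notMem hx)
  have ha1 : a ≠ 1 := by rintro rfl; exact ha (one_mem _)
  have hmove : switched a r S a ≠ a := by
    rcases hstep a with h' | h' <;> rw [h', Ne, mul_eq_left]
    exacts [ha1, hra]
  have hlast : (switched a r S)⁻¹ a = r⁻¹ := by
    rw [Perm.inv_eq_iff_eq, switched_of_mem, inv_mul_cancel, one_mul]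
    rwa [← one_mul r⁻¹, mk_mul_inv_self]
  refine ⟨(switched a r S).toList a, nodup_toList _ _,
    (isChain_toList _ _).imp fun x y (hxy : y = _) => hxy ▸ hstep x, head?_toList hmove,
    hlast ▸ getLast?_toList hmove, fun x => ?_⟩
  rw [mem_toList_iff, h.sameCycle_iff ha haN, and_iff_left (mem_support.2 hmove)]

end CycleList

section Code

theorem length_add_card_of_mem_iff {G : Type*} [Group G] [Finite G] {H K : Subgroup G}
    (hHK : H ≤ K) {C : List G} (hC : C.Nodup) (hmem : ∀ x, x ∈ C ↔ x ∈ K ∧ x ∉ H) :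
    C.length + Nat.card H = Nat.card K := by
  classical
  have hset : ((C.toFinset : Finset G) : Set G) = (K : Set G) \ H := by
    ext x
    simpa using hmem x
  rw [← List.toFinset_card_of_nodup hC, ← Set.ncard_coe_finset, hset]
  exact Set.ncard_sdiff_add_ncard_of_subset hHK

variable {q : ℕ}

theorem rot_notMem_zpowers_base_rot : rot (q + 4) ∉ zpowers (base q (rot (q + 2))) := by
  rw [← MonoidHom.map_zpowers]
  rintro ⟨y, -, hy⟩
  have hfix : rot (q + 4) (Fin.last (q + 3)) = Fin.last (q + 3) := by
    rw [← hy]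
    exact firstLetters_of_le _ y (by simp)
  rw [rot_apply, sub_eq_self] at hfix
  simp at hfix

theorem card_zpowers_base_rot : Nat.card (zpowers (base q (rot (q + 2)))) = q + 2 := by
  rw [Nat.card_zpowers, orderOf_injective _ (firstLetters_injective _), orderOf_rot]

theorem base_rot_mem_alternatingGroup (hq : Odd q) :
    base q (rot (q + 2)) ∈ alternatingGroup (Fin (q + 4)) := by
  rw [mem_alternatingGroup, sign_firstLetters, sign_rot (hq.add_even even_two)]

theorem exists_list_alternatingGroup (hq : Odd q) : ∃ C : List (Perm (Fin (q + 4))), C.Nodup ∧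
    C.IsChain (fun x y => y = x * rot (q + 4) ∨ y = x * base q (rot (q + 2))) ∧
    C.head? = some (rot (q + 4)) ∧ C.getLast? = some (rot (q + 4) * (base q (rot (q + 2)))⁻¹) ∧
    ∀ x, x ∈ C ↔ x ∈ alternatingGroup (Fin (q + 4)) ∧ x ∉ zpowers (base q (rot (q + 2))) := by
  obtain ⟨S, hS⟩ := exists_isJoined_alternatingGroup hq
  have hne : base q (rot (q + 2)) ≠ 1 := by
    rw [Ne, map_eq_one_iff _ (firstLetters_injective _), ← orderOf_eq_one_iff, orderOf_rot]
    omega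
  have hrot : rot (q + 4) ∈ alternatingGroup (Fin (q + 4)) :=
    mem_alternatingGroup.2 (sign_rot (hq.add_even (by decide : Even 4)))
  have hmk (x : Perm (Fin (q + 4))) : (x : Perm (Fin (q + 4)) ⧸ zpowers (rot (q + 4))) ∈
      (QuotientGroup.mk '' (alternatingGroup (Fin (q + 4)) : Set (Perm (Fin (q + 4)))) : Set _) ↔
      x ∈ alternatingGroup (Fin (q + 4)) := by
    refine ⟨?_, fun hx => ⟨x, hx, rfl⟩⟩
    rintro ⟨y, hy, hyx⟩
    simpa using mul_mem hy (Subgroup.zpowers_le.2 hrot (QuotientGroup.eq.1 hyx))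
  have hlist := hS.exists_list
  rw [← base_rot] at hlist
  obtain ⟨C, hnodup, hchain, hhead, hlast, hmem⟩ := hlist rot_notMem_zpowers_base_rot hne
  refine ⟨C, hnodup, hchain, hhead, ?_, fun x => by rw [hmem, hmk]⟩
  rw [hlast, base_rot, mul_inv_rev, mul_inv_cancel_left]

theorem pushToTop_eq {n : ℕ} (j : Fin n) (σ : Perm (Fin n)) :
    pushToTop j σ = σ * (Fin.cycleRange j)⁻¹ := rfl

theorem pushToTop_inv_eq {n : ℕ} (j : Fin n) (σ : Perm (Fin n)) :
    (pushToTop j)⁻¹ σ = σ * Fin.cycleRange j := by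
  rw [Perm.inv_eq_iff_eq, pushToTop_eq, mul_inv_cancel_right]

theorem isPushToTopCode_map {G : Type*} [Group G] {n : ℕ} {f : G →* Perm (Fin n)}
    (hf : Function.Injective f) {a b v : G} {i j : Fin n} (hi : 0 < (i : ℕ)) (hj : 0 < (j : ℕ))
    (ha : f a = (Fin.cycleRange i)⁻¹) (hb : f b = (Fin.cycleRange j)⁻¹) {C : List G}
    (hnodup : C.Nodup) (hchain : C.IsChain fun x y => y = x * a ∨ y = x * b)
    (hhead : C.head? = some v) (hlast : C.getLast? = some (v * b⁻¹)) (σ : Perm (Fin n)) :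
    IsPushToTopCode n C.length (C.map fun x => σ * f x) := by
  have hne : C ≠ [] := by rintro rfl; simp at hhead
  rw [List.head?_eq_some_head hne, Option.some_inj] at hhead
  rw [List.getLast?_eq_some_getLast hne, Option.some_inj] at hlast
  refine ⟨⟨⟨hnodup.map ((mul_right_injective σ).comp hf), ?_⟩, by simpa using hne,
    pushToTop j, ⟨j, hj, rfl⟩, ?_⟩, List.length_map _⟩
  · rw [List.isChain_map]
    refine hchain.imp ?_
    rintro x _ (rfl | rfl)
    · exact ⟨_, ⟨i, hi, rfl⟩, by rw [pushToTop_eq, map_mul, ha, mul_assoc]⟩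
    · exact ⟨_, ⟨j, hj, rfl⟩, by rw [pushToTop_eq, map_mul, hb, mul_assoc]⟩
  · rw [List.head_map, List.getLast_map, hhead, hlast, pushToTop_eq, ← hb, mul_assoc, ← map_mul,
      inv_mul_cancel_right]

theorem exists_isPushToTopCode {m : ℕ} (hm : 2 ≤ m) (σ : Perm (Fin (2 * m + 2))) :
    ∃ C : List (Perm (Fin (2 * m + 2))), 2 * (C.length + (2 * m - 1)) = (2 * m + 1).factorial ∧
      IsPushToTopCode (2 * m + 2) C.length C ∧ ParityPreserving C ∧
      C.head? = some (pushToTop (idxB m) σ) ∧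
      C.getLast? = some ((pushToTop (idxA m))⁻¹ (pushToTop (idxB m) σ)) ∧
      (∀ τ ∈ C, τ (idxC m) = σ (idxC m)) ∧ σ ∉ C := by
  obtain ⟨q, hqm⟩ : ∃ q, 2 * m = q + 3 := ⟨2 * m - 3, by omega⟩
  have hq : Odd q := ⟨m - 2, by omega⟩
  have hle : q + 4 ≤ 2 * m + 2 := by omega
  obtain ⟨C, hnodup, hchain, hhead, hlast, hmem⟩ := exists_list_alternatingGroup hq
  have hB : firstLetters hle (rot (q + 4)) = (Fin.cycleRange (idxB m))⁻¹ := by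
    rw [firstLetters_rot]
    simp only [idxB, hqm]
  have hA : firstLetters hle (base q (rot (q + 2))) = (Fin.cycleRange (idxA m))⁻¹ := by
    rw [firstLetters_firstLetters, firstLetters_rot]
    simp only [idxA, hqm, Nat.reduceSubDiff]
  refine ⟨C.map fun x => σ * firstLetters hle x, ?_, ?_, ?_, ?_, ?_, ?_, ?_⟩
  · have hlen := length_add_card_of_mem_iff
      (Subgroup.zpowers_le.2 (base_rot_mem_alternatingGroup hq)) hnodup hmem
    rw [card_zpowers_base_rot] at hlen
    rw [List.length_map, hqm, Nat.add_sub_assoc (by omega), hlen,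
      two_mul_nat_card_alternatingGroup, Nat.card_perm, Nat.card_fin]
  · rw [List.length_map]
    exact isPushToTopCode_map (firstLetters_injective hle) (by simp only [idxB]; omega)
      (by simp only [idxA]; omega) hB hA hnodup hchain hhead hlast σ
  · simp only [ParityPreserving, List.forall_mem_map]
    intro x hx y hy
    rw [Perm.sign_mul, Perm.sign_mul, sign_firstLetters, sign_firstLetters,
      mem_alternatingGroup.1 ((hmem x).1 hx).1, mem_alternatingGroup.1 ((hmem y).1 hy).1]
  · rw [List.head?_map, hhead, Option.map_some, pushToTop_eq, hB]
  · rw [List.getLast?_map, hlast, Option.map_some, pushToTop_inv_eq, pushToTop_eq, map_mul, map_inv,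
      hA, hB, inv_inv, mul_assoc]
  · simp only [List.forall_mem_map]
    intro x _
    rw [mul_apply, firstLetters_of_le hle x (by simp only [idxC]; omega)]
  · rw [List.mem_map]
    rintro ⟨x, hx, hxσ⟩
    obtain rfl : x = 1 := firstLetters_injective hle (by rw [mul_eq_left.1 hxσ, map_one])
    exact ((hmem 1).1 hx).2 (one_mem _)

end Code

section LastLetter

open scoped Fin.CommRing

/-- The permutation by which `phi m` multiplies on the right. -/
def phiPerm (m : ℕ) : Perm (Fin (2 * m + 2)) :=
  Fin.cycleRange (idxA m) * rot (2 * m + 2) ^ 2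

theorem cycleRange_idxC_inv (m : ℕ) : (Fin.cycleRange (idxC m))⁻¹ = rot (2 * m + 2) :=
  congrArg (·⁻¹) (Fin.cycleRange_last (2 * m + 1))

theorem phi_eq_mulRight (m : ℕ) : phi m = Equiv.mulRight (phiPerm m) := by
  ext1 σ
  rw [phi, mul_apply, pushToTop_inv_eq, pow_two, mul_apply, pushToTop_eq, pushToTop_eq,
    cycleRange_idxC_inv, coe_mulRight, phiPerm, pow_two]
  simp only [mul_assoc]

theorem piHat_eq_pow (m r : ℕ) : piHat m r = phiPerm m ^ r := by
  rw [piHat, phi_eq_mulRight, pow_mulRight, coe_mulRight]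
  exact one_mul _

theorem val_rot_sq_apply {n : ℕ} {i : Fin (n + 2)} (hi : 2 ≤ (i : ℕ)) :
    ((rot (n + 2) ^ 2) i : ℕ) = i - 2 := by
  rw [rot_pow_apply, Fin.sub_val_of_le]
  · rw [Fin.val_natCast, Nat.mod_eq_of_lt (by omega)]
  · rw [Fin.le_def, Fin.val_natCast, Nat.mod_eq_of_lt (by omega)]
    exact hi

theorem phiPerm_apply_of_two_le {m : ℕ} {k : Fin (2 * m + 2)} (hk : 2 ≤ (k : ℕ))
    (hkm : (k : ℕ) < 2 * m) : (phiPerm m k : ℕ) = k - 1 := by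
  rw [phiPerm, mul_apply, Fin.coe_cycleRange_of_lt, val_rot_sq_apply hk]
  · omega
  · rw [Fin.lt_def, val_rot_sq_apply hk]
    simp only [idxA]
    omega

theorem phiPerm_idxC {m : ℕ} (hm : 1 ≤ m) : (phiPerm m (idxC m) : ℕ) = 2 * m - 1 := by
  have hval := val_rot_sq_apply (i := idxC m) (by simp only [idxC]; omega)
  simp only [idxC, Nat.reduceSubDiff] at hval
  rw [phiPerm, mul_apply, Fin.cycleRange_of_gt, idxC, hval]
  rw [Fin.lt_def, idxC, hval]
  simp only [idxA]
  omega

theorem phiPerm_one {m : ℕ} (hm : 1 ≤ m) : phiPerm m 1 = idxC m := by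
  have hrot : (rot (2 * m + 2) ^ 2) 1 = idxC m := by
    rw [rot_pow_apply, sub_eq_iff_eq_add]
    ext
    have hmod : (2 * m + 1 + 2) % (2 * m + 2) = 1 := by
      rw [show 2 * m + 1 + 2 = 1 + (2 * m + 2) by omega, Nat.add_mod_right,
        Nat.mod_eq_of_lt (by omega)]
    simp [Fin.val_add, idxC, hmod]
  rw [phiPerm, mul_apply, hrot, Fin.cycleRange_of_gt]
  exact Fin.lt_def.2 (by simp only [idxA, idxC]; omega)

theorem val_phiPerm_pow_idxC {m s : ℕ} (hs : s ≠ 0) (hsm : s < 2 * m) :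
    ((phiPerm m ^ s) (idxC m) : ℕ) = 2 * m - s := by
  induction s, Nat.one_le_iff_ne_zero.2 hs using Nat.le_induction with
  | base => rw [pow_one, phiPerm_idxC (by omega)]
  | succ s hs1 ih =>
    have ih := ih (by omega) (by omega)
    rw [pow_succ', mul_apply, phiPerm_apply_of_two_le (by omega) (by omega), ih]
    omega

theorem phiPerm_pow_two_mul_idxC {m : ℕ} (hm : 1 ≤ m) :
    (phiPerm m ^ (2 * m)) (idxC m) = idxC m := by
  have h1 : (phiPerm m ^ (2 * m - 1)) (idxC m) = 1 := by
    ext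
    rw [val_phiPerm_pow_idxC (by omega) (by omega), Fin.val_one]
    omega
  rw [← mul_pow_sub_one (by omega), mul_apply, h1, phiPerm_one hm]

theorem val_piHat_idxC {m : ℕ} (hm : 1 ≤ m) (r : ℕ) :
    (piHat m r (idxC m) : ℕ) =
      if r % (2 * m) = 0 then 2 * m + 1 else 2 * m - r % (2 * m) := by
  have hper : Function.IsPeriodicPt (phiPerm m) (2 * m) (idxC m) := by
    rw [Function.IsPeriodicPt, Function.IsFixedPt, iterate_eq_pow, phiPerm_pow_two_mul_idxC hm]
  rw [piHat_eq_pow, ← iterate_eq_pow, ← hper.iterate_mod_apply, iterate_eq_pow]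
  split_ifs with h
  · rw [h, pow_zero, one_apply, idxC]
  · exact val_phiPerm_pow_idxC h (Nat.mod_lt _ (by omega))

theorem cycleRange_idxC_mul_swap (m : ℕ) :
    Fin.cycleRange (idxC m) * swap (idxB m) (idxC m) = Fin.cycleRange (idxB m) := by
  have hBC : idxB m < idxC m := Fin.lt_def.2 (by simp [idxB, idxC])
  ext1 k
  rw [mul_apply]
  obtain hB | rfl | hB := lt_trichotomy k (idxB m)
  · have hC := hB.trans hBC
    rw [swap_apply_of_ne_of_ne hB.ne hC.ne, Fin.cycleRange_of_lt hB, Fin.cycleRange_of_lt hC]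
  · rw [swap_apply_left, Fin.cycleRange_self, Fin.cycleRange_self]
  · obtain rfl : k = idxC m := Fin.ext (by simp only [idxC, idxB, Fin.lt_def] at hB ⊢; omega)
    rw [swap_apply_right, Fin.cycleRange_of_gt hBC, Fin.cycleRange_of_lt hBC]
    exact Fin.ext (Fin.val_add_one_of_lt hBC)

theorem pushToTop_sigmaTilde (m r : ℕ) : pushToTop (idxB m) (sigmaTilde m r) = piHat m r := by
  rw [pushToTop_eq, sigmaTilde, pushToTop_inv_eq, mul_assoc (piHat m r),
    cycleRange_idxC_mul_swap, mul_inv_cancel_right]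

theorem sigmaTilde_idxC (m r : ℕ) : sigmaTilde m r (idxC m) = piHat m r (idxC m) := by
  rw [← pushToTop_sigmaTilde, pushToTop_apply_of_gt]
  exact Fin.lt_def.2 (by simp [idxB, idxC])

end LastLetter

end RankMod

theorem mainTheorem6 (m : ℕ) (hm : 2 ≤ m) (r : ℕ) :
    (∃ (M : ℕ) (C : List (Equiv.Perm (Fin (2 * m + 2)))),
      (M : ℚ) = (Nat.factorial (2 * m + 1) : ℚ) / 2 - (2 * (m : ℚ) - 1) ∧
      RankMod.IsPushToTopCode (2 * m + 2) M C ∧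
      RankMod.ParityPreserving C ∧
      C.head? = some (RankMod.piHat m r) ∧
      C.getLast? = some ((RankMod.pushToTop (RankMod.idxA m))⁻¹ (RankMod.piHat m r)) ∧
      (∀ π ∈ C, π (RankMod.idxC m) = RankMod.piHat m r (RankMod.idxC m)) ∧
      RankMod.sigmaTilde m r ∉ C) ∧
    -- the value of the last entry, in `{1, …, 2m + 2}`
    ((RankMod.piHat m r (RankMod.idxC m) : ℕ) : ℤ) + 1 =
      (if r % (2 * m) = 0 then 2 * (m : ℤ) + 2
        else 2 * (m : ℤ) + 1 - ((r % (2 * m) : ℕ) : ℤ)) ∧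
    RankMod.sigmaTilde m r =
      (RankMod.pushToTop (RankMod.idxB m))⁻¹ (RankMod.piHat m r) ∧
    RankMod.sigmaTilde m r (RankMod.idxC m) = RankMod.piHat m r (RankMod.idxC m) := by
  obtain ⟨C, hlen, hC, hparity, hhead, hlast, hend, hmiss⟩ :=
    RankMod.exists_isPushToTopCode hm (RankMod.sigmaTilde m r)
  simp only [RankMod.pushToTop_sigmaTilde, RankMod.sigmaTilde_idxC] at hhead hlast hend
  refine ⟨⟨C.length, C, ?_, hC, hparity, hhead, hlast, hend, hmiss⟩, ?_, ?_,
    RankMod.sigmaTilde_idxC m r⟩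
  · rw [← hlen]
    push_cast [Nat.cast_sub (show 1 ≤ 2 * m by omega)]
    ring
  · rw [RankMod.val_piHat_idxC (by omega) r]
    have hr : r % (2 * m) < 2 * m := Nat.mod_lt _ (by omega)
    split_ifs <;> omega
  · exact Equiv.Perm.eq_inv_iff_eq.2 (RankMod.pushToTop_sigmaTilde m r)
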